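/- **Setting.** An entailment system has sets of antecedents $A$ and consequents $C$, sequents $A\vdash C$, and a set of rules, each a set of instances $(S,(S_1,\dots,S_n))$ of a conclusion and finitely many premises (axiomatic if $n=0$). It has models with satisfaction relations $m\models A$, $m\models C$; $A\vdash C$ is valid if $m\models A$ implies $m\models C$ for all $m$. Each antecedent and each consequent has a finite set of left-hand, resp. right-hand, trace values. For every rule instance and every $i\le n$ there are two partial functions (the trace pair function) assigning ordinals to pairs (trace value of $S$, trace value of $S_i$), one for left-hand and one for right-hand values. An ordinal trace function $\mathcal O$ is a partial function from pairs (trace value, model) to ordinals, defined on $(\tau,m)$ whenever $\tau$ is a trace value of some $A$ with $m\models A$, and such that whenever $m$ is a counter-model of the conclusion of an instance of a rule of the system there are a premise $S_i$ and a counter-model $m'$ of $S_i$ with $\mathcal O(\sigma',m')+\alpha\le\mathcal O(\sigma,m)$ for each left-hand pair $(\sigma,\sigma')$ with value $\alpha$ for that premise. Fix also a predicate "the instance $(A\vdash C,\vec S)$ excludes the right-hand trace value $\tau$ of $C$" that holds only if $A$ has no model or no model $m$ of $A$ has $\mathcal O(\tau,m)$ defined. For $S=A\vdash C$: $\tau$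 is *ground* for (an instance with conclusion) $S$ if validity of $S$ implies that $\mathcal O(\tau,m)$, when defined, is the least value of $\mathcal O$ for all $m\models A$; and $\tau_1=_S\tau_2$ if validity of $S$ implies $\mathcal O(\tau_1,m)=\mathcal O(\tau_2,m)$ for all $m\models A$ with $\mathcal O(\tau_2,m)$ defined. Let $\mathcal P$ be a cyclic proof: a finite directed graph with ordered, distinct children, whose nodes $\nu$ carry rule instances (the sequent of $\nu$ and those of its children; $\nu$ is axiomatic if it has no children), such that every infinite path has a tail followed by a left-hand trace with infinitely many steps of value $>0$. A trace $\tau_1\dots\tau_k$ *follows* a path $\nu_1\nu_2\dots$ if each $(\tau_i,\tau_{i+1})$, $i<k$, is in the domain of the trace pair function $\delta^{(\nu_i,\nu_{i+1})}$ (left- or right-hand accordingly); its *size* is the ordinal $\delta^{(\nu_{k-1},\nu_k)}(\tau_{k-1},\tau_k)+\dots+\delta^{(\nu_1,\nu_2)}(\tau_1,\tau_2)$. A right-hand value $\tau$ is *terminal* for $\nu$ if no pair $(\tau,\cdot)$ is a trace pair for any edge from $\nu$. A right-hand trace $\tau_1\dots\tau_n$ is *positive maximal* if $\tau_n$ is terminal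 for $\nu_n$ and not excluded by $\nu_n$. For ${\sim}\in\{<,\le\}$, write $\tau'\sim^\nu_{\mathcal P}\tau$ if for every positive maximal right-hand trace $\vec\sigma_{1..n}$ with $\sigma_1=\tau'$ following a path $\vec\nu$ from $\nu$ there is a left-hand trace $\vec\sigma'_{1..k}$, $k\le n$, $\sigma'_1=\tau$, following $\vec\nu$ with $\mathrm{size}(\vec\sigma)\sim\mathrm{size}(\vec\sigma')$, and either $\sigma_n$ is ground for $\nu_n$, or $\nu_n$ is axiomatic, $k=n$ and $\sigma'_n=_{S}\sigma_n$ for the sequent $S$ of $\nu_n$. **Automata.** Weights are ordinals with a least element $\bot$ adjoined. The value of an accepting run with weights $\alpha_1,\dots,\alpha_m$ is $\alpha_m+\dots+\alpha_1$, that of a non-accepting run is $\bot$; $L(w)$ is the maximum of the values of the runs on $w$ ($\bot$ if none). $L\le L'$ means $L(w)\le L'(w)$ for all $w$; $L<L'$ means $L(w)<L'(w)$ for all $w$ with $L(w)\ne\bot$. Letters are the nodes and the pairs $(T,\sigma)$ of a set $T$ of left-hand and a right-hand trace value $\sigma$ of $\mathcal P$. Let $T_\nu(\sigma)$ be the set of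 left-hand trace values $\rho$ of $\nu$ with $\rho=_S\sigma$, $S$ the sequent of $\nu$. Fix a node $\nu_0$, and trace values $\tau$ (left) and $\tau'$ (right) of $\nu_0$. * $B$ has states $(\nu,\sigma)$ ($\sigma$ a right-hand trace value of $\mathcal P$), $\bot$ and the initial state $q$; transitions $q\xrightarrow{\nu_0}(\nu_0,\tau')$; $(\nu,\sigma)\xrightarrow{\nu'}(\nu',\sigma')$, of weight $\delta^{(\nu,\nu')}(\sigma,\sigma')$, for right-hand trace pairs of edges $(\nu,\nu')$; and $(\nu,\sigma)\xrightarrow{(T_\nu(\sigma),\sigma)}\bot$ if $\nu$ is axiomatic, $\sigma$ is a trace value of $\nu$, not ground for and not excluded by $\nu$. Other weights are $0$. Final states: $\bot$, and those $(\nu,\sigma)$ with $\sigma$ not excluded by $\nu$ and either $\nu$ not axiomatic and $\sigma$ terminal for $\nu$, or $\nu$ axiomatic and $\sigma$ ground for $\nu$. $B$ is *grounded* if $\sigma$ is ground for $\nu$ for each reachable final state $(\nu,\sigma)$. * $A(n)$, $n>0$, has states $(\nu,\rho)$ ($\rho$ a left-hand trace value of $\mathcal P$), $\bot$, $\top^i_\nu$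 for $0<i\le n$, and the initial state $q$, all but $q$ final; transitions $q\xrightarrow{\nu_0}(\nu_0,\tau)$; $(\nu,\rho)\xrightarrow{\nu'}(\nu',\rho')$, of weight $\delta^{(\nu,\nu')}(\rho,\rho')$, for left-hand trace pairs of edges; $(\nu,\rho)\xrightarrow{(T_\nu(\sigma),\sigma)}\bot$ for $\nu$ axiomatic, $\sigma$ a right-hand trace value of $\nu$, $\rho\in T_\nu(\sigma)$; $(\nu,\rho)\xrightarrow{\nu'}\top^1_{\nu'}$ for edges $(\nu,\nu')$; $\top^i_\nu\xrightarrow{\nu'}\top^i_\nu$ for $\nu'\ne\nu$; and $\top^i_\nu\xrightarrow{\nu}\top^{i+1}_\nu$ for $i<n$. Other weights are $0$. **Hypotheses.** Call $(\nu,\sigma)$ reachable if some trace following a path leads to it from $(\nu_0,\tau)$ (left-hand) or $(\nu_0,\tau')$ (right-hand). A *cycle* is a trace with at least one step following a path such that the first and last (node, trace value) pairs agree; it is *simple* if no such pair is otherwise repeated. A *binary cycle* is a pair of left-hand cycles along the same path, simple if no triple (node, value, value) is repeated except that the first equals the last. Assume $\mathcal P$ is 1. *finitely progressing*: trace pairs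 starting at a reachable $(\nu,\sigma)$ have finite values (left and right); 2. *dynamic*: each simple cycle (left or right) starting at a reachable pair has size $>0$; 3. *balanced*: the two cycles of each simple binary left-hand cycle, both starting at reachable pairs, have equal size. Let $\mathbf W$ be the maximum number of left-hand, or of right-hand, trace values of a node, $\mathbf C$ the number of triples $(\rho,\rho',\nu)$ with $\rho,\rho'$ left-hand trace values of $\nu$, and $\mathrm{maxStep}$ the largest value of a left-hand trace pair of an edge of $\mathcal P$ that starts at a reachable $(\nu,\rho)$ ($0$ if there is none). **Theorem.** $N=2+\mathbf C\cdot\mathrm{maxStep}\cdot\mathbf W+\mathbf W$ is a natural number, and for every $n\ge N$ (in particular $n=N$) and each ${\sim}\in\{<,\le\}$, $$L_B\sim L_{A(n)}\ \text{ and } B \text{ is grounded}\iff \tau'\sim^{\nu_0}_{\mathcal P}\tau .$$ Moreover, if the trace pair function is trace injective (for each rule instance, premise and side, $(\sigma,\rho)$ and $(\sigma',\rho)$ both in its domain implies $\sigma=\sigma'$), then $A(n)$ is finitely ambiguous: the number of its runs on a word is bounded. -/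

import Mathlib

universe u v

/-! ### Cyclic entailment systems -/

/-- An entailment proof system. Sequents are pairs of an antecedent and a consequent, a rule instance
is a conclusion together with its list of premises, `rules r` is the rule with index `r`, and `active`
is the set of (indices of) the rules of the system. -/
structure EntailmentSystem where
  Ante : Type u
  Cons : Type u
  Rule : Type u
  rules : Rule → Set ((Ante × Cons) × List (Ante × Cons))
  active : Set Rule

/-- A cyclic entailment system: an entailment proof system with a semantics, trace values and a
trace pair function. The partial functions `δA r I i` and `δC r I i` are the left-hand and right-hand
trace pair functions of the instance `I` of rule `r` with respect to its `i`-th premise. -/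
structure CyclicSystem extends EntailmentSystem.{u} where
  Model : Type u
  satA : Model → Ante → Prop
  satC : Model → Cons → Prop
  TA : Type u
  TC : Type u
  valsA : Ante → Finset TA
  valsC : Cons → Finset TC
  δA : Rule → (I : (Ante × Cons) × List (Ante × Cons)) → Fin I.2.length → TA → TA → Option Ordinal.{v}
  δC : Rule → (I : (Ante × Cons) × List (Ante × Cons)) → Fin I.2.length → TC → TC → Option Ordinal.{v}
  δA_dom : ∀ r, ∀ I ∈ rules r, ∀ i τ τ', (δA r I i τ τ').isSome →
    τ ∈ valsA I.1.1 ∧ τ' ∈ valsA (I.2.get i).1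
  δC_dom : ∀ r, ∀ I ∈ rules r, ∀ i τ τ', (δC r I i τ τ').isSome →
    τ ∈ valsC I.1.2 ∧ τ' ∈ valsC (I.2.get i).2

namespace CyclicSystem

abbrev Sequent (E : CyclicSystem.{u, v}) := E.Ante × E.Cons

abbrev Instance (E : CyclicSystem.{u, v}) := E.Sequent × List E.Sequent

def Sat (E : CyclicSystem.{u, v}) (m : E.Model) (S : E.Sequent) : Prop :=
  E.satA m S.1 → E.satC m S.2

def Valid (E : CyclicSystem.{u, v}) (S : E.Sequent) : Prop := ∀ m, E.Sat m S

/-- The trace pair function is trace injective. -/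
def TraceInjective (E : CyclicSystem.{u, v}) : Prop :=
  ∀ r, ∀ I ∈ E.rules r, ∀ i,
    (∀ τ τ' τ'', (E.δA r I i τ' τ).isSome → (E.δA r I i τ'' τ).isSome → τ' = τ'') ∧
    (∀ τ τ' τ'', (E.δC r I i τ' τ).isSome → (E.δC r I i τ'' τ).isSome → τ' = τ'')

end CyclicSystem

/-- An ordinal trace function with the descending counter-model property. -/
structure OrdinalTraceFunction (E : CyclicSystem.{u, v}) where
  ord : E.TA ⊕ E.TC → E.Model → Option Ordinal.{v}
  defined : ∀ A, ∀ τ ∈ E.valsA A, ∀ m, E.satA m A → (ord (.inl τ) m).isSome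
  descending : ∀ r ∈ E.active, ∀ I ∈ E.rules r, ∀ m, ¬ E.Sat m I.1 →
    ∃ m', ∃ i : Fin I.2.length, ¬ E.Sat m' (I.2.get i) ∧
      ∀ τ τ' α, E.δA r I i τ τ' = some α →
        ∃ β β', ord (.inl τ) m = some β ∧ ord (.inl τ') m' = some β' ∧ β' + α ≤ β

namespace OrdinalTraceFunction

/-- The least value taken by the ordinal trace function. -/
noncomputable def least {E : CyclicSystem.{u, v}} (O : OrdinalTraceFunction E) : Ordinal.{v} :=
  sInf {α | ∃ τ m, O.ord τ m = some α}

/-- The consequent trace value `τ` is ground with respect to (an instance with conclusion) `S`.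
This is only used for trace values that are terminal for the instance. -/
def Ground {E : CyclicSystem.{u, v}} (O : OrdinalTraceFunction E) (S : E.Sequent) (τ : E.TC) : Prop :=
  E.Valid S → ∀ m, E.satA m S.1 → ∀ α, O.ord (.inr τ) m = some α → α = O.least

/-- The sequent `S` equates the trace values `τ` and `τ'`. -/
def Equates {E : CyclicSystem.{u, v}} (O : OrdinalTraceFunction E) (S : E.Sequent)
    (τ : E.TA) (τ' : E.TC) : Prop :=
  E.Valid S → ∀ m, E.satA m S.1 → (O.ord (.inr τ') m).isSome →
    O.ord (.inl τ) m = O.ord (.inr τ') m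

end OrdinalTraceFunction

/-- An exclusion predicate on rule instances and consequent trace values. -/
structure ExclusionPredicate {E : CyclicSystem.{u, v}} (O : OrdinalTraceFunction E) where
  excludes : E.Instance → E.TC → Prop
  sound : ∀ I τ, τ ∈ E.valsC I.1.2 → excludes I τ →
    (¬ ∃ m, E.satA m I.1.1) ∨ ¬ ∃ m, E.satA m I.1.1 ∧ (O.ord (.inr τ) m).isSome

/-! ### Pre-proofs, paths and traces -/

/-- A cyclic pre-proof: a finite directed graph in which the children of each node are ordered
(without repetition, as edges are pairs of nodes), each node representing a rule instance. -/
structure PreProof (E : CyclicSystem.{u, v}) where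
  Node : Type u
  [fintypeNode : Fintype Node]
  children : Node → List Node
  children_nodup : ∀ ν, (children ν).Nodup
  seq : Node → E.Sequent
  rule : Node → E.Rule
  rule_mem : ∀ ν, rule ν ∈ E.active
  inst_mem : ∀ ν, (seq ν, (children ν).map seq) ∈ E.rules (rule ν)

attribute [instance] PreProof.fintypeNode

/-! Below, a finite sequence with entries numbered `0, …, n` is given by the first `n + 1` entries
of a function on `ℕ`; the number `n` of its steps is then one less than its length. The function
`d ν ν' τ τ'` stands for the (left-hand or right-hand) trace pair function of the edge `(ν, ν')`. -/

/-- `a (n-1) + ⋯ + a 1 + a 0` (in this order). -/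
noncomputable def revSum (a : ℕ → Ordinal.{v}) : ℕ → Ordinal.{v}
  | 0 => 0
  | n + 1 => a n + revSum a n

namespace Trace

/-- The trace `t 0, …, t n` follows the path `p 0, …, p n`. -/
def Follows {N T : Type*} (d : N → N → T → T → Option Ordinal.{v}) (p : ℕ → N) (t : ℕ → T)
    (n : ℕ) : Prop :=
  ∀ i < n, (d (p i) (p (i + 1)) (t i) (t (i + 1))).isSome

/-- The size of the trace `t 0, …, t n` along the path `p 0, …, p n`. -/
noncomputable def size {N T : Type*} (d : N → N → T → T → Option Ordinal.{v}) (p : ℕ → N) (t : ℕ → T)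
    (n : ℕ) : Ordinal.{v} :=
  revSum (fun i => (d (p i) (p (i + 1)) (t i) (t (i + 1))).getD 0) n

/-- `(ν', τ')` is reachable from `(ν, τ)`. -/
def Reachable {N T : Type*} (d : N → N → T → T → Option Ordinal.{v}) (ν : N) (τ : T)
    (ν' : N) (τ' : T) : Prop :=
  ∃ (n : ℕ) (p : ℕ → N) (t : ℕ → T), p 0 = ν ∧ t 0 = τ ∧ p n = ν' ∧ t n = τ' ∧ Follows d p t n

/-- The trace `t 0, …, t n` is a cycle along the path `p 0, …, p n`. -/
def IsCycle {N T : Type*} (d : N → N → T → T → Option Ordinal.{v}) (p : ℕ → N) (t : ℕ → T)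
    (n : ℕ) : Prop :=
  0 < n ∧ Follows d p t n ∧ p 0 = p n ∧ t 0 = t n

def IsSimpleCycle {N T : Type*} (d : N → N → T → T → Option Ordinal.{v}) (p : ℕ → N) (t : ℕ → T)
    (n : ℕ) : Prop :=
  IsCycle d p t n ∧ ∀ i j, 0 < i → i < j → j ≤ n → ¬ (p i = p j ∧ t i = t j)

/-- The pair of traces `t`, `t'` is a simple binary cycle along `p`. -/
def IsSimpleBinaryCycle {N T : Type*} (d : N → N → T → T → Option Ordinal.{v}) (p : ℕ → N)
    (t t' : ℕ → T) (n : ℕ) : Prop :=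
  IsCycle d p t n ∧ IsCycle d p t' n ∧
    ∀ i j, 0 < i → i < j → j ≤ n → ¬ (p i = p j ∧ t i = t j ∧ t' i = t' j)

/-- All steps of traces from `(ν, τ)` are finite ordinals. -/
def FinitelyProgressing {N T : Type*} (d : N → N → T → T → Option Ordinal.{v}) (ν₀ : N) (τ₀ : T) :
    Prop :=
  ∀ ν ν' τ τ' α, Reachable d ν₀ τ₀ ν τ → d ν ν' τ τ' = some α → α < Ordinal.omega0

def Dynamic {N T : Type*} (d : N → N → T → T → Option Ordinal.{v}) (ν₀ : N) (τ₀ : T) : Prop :=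
  ∀ n p t, IsSimpleCycle d p t n → Reachable d ν₀ τ₀ (p 0) (t 0) → 0 < size d p t n

def Balanced {N T : Type*} (d : N → N → T → T → Option Ordinal.{v}) (ν₀ : N) (τ₀ : T) : Prop :=
  ∀ n p t t', IsSimpleBinaryCycle d p t t' n → Reachable d ν₀ τ₀ (p 0) (t 0) →
    Reachable d ν₀ τ₀ (p 0) (t' 0) → size d p t n = size d p t' n

end Trace

namespace PreProof

/-- The rule instance represented by a node. -/
def inst {E : CyclicSystem.{u, v}} (P : PreProof E) (ν : P.Node) : E.Instance :=
  (P.seq ν, (P.children ν).map P.seq)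

def Edge {E : CyclicSystem.{u, v}} (P : PreProof E) (ν ν' : P.Node) : Prop := ν' ∈ P.children ν

def Axiomatic {E : CyclicSystem.{u, v}} (P : PreProof E) (ν : P.Node) : Prop := P.children ν = []

def valsA {E : CyclicSystem.{u, v}} (P : PreProof E) (ν : P.Node) : Finset E.TA := E.valsA (P.seq ν).1

def valsC {E : CyclicSystem.{u, v}} (P : PreProof E) (ν : P.Node) : Finset E.TC := E.valsC (P.seq ν).2

open Classical in
/-- The position of the child `ν'` among the premises of the instance represented by `ν`. -/
noncomputable def premise {E : CyclicSystem.{u, v}} (P : PreProof E) (ν ν' : P.Node) (h : P.Edge ν ν') :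
    Fin (P.inst ν).2.length :=
  ⟨(P.children ν).idxOf ν', by
    simpa [inst] using List.idxOf_lt_length_of_mem h⟩

open Classical in
/-- The left-hand trace pair function of `(ν, ν')`, nowhere defined if `(ν, ν')` is not an edge;
so every sequence of nodes that is followed by a trace is a path. -/
noncomputable def stepA {E : CyclicSystem.{u, v}} (P : PreProof E) (ν ν' : P.Node) (τ τ' : E.TA) :
    Option Ordinal.{v} :=
  if h : P.Edge ν ν' then E.δA (P.rule ν) (P.inst ν) (P.premise ν ν' h) τ τ' else none

open Classical in
/-- The right-hand trace pair function of `(ν, ν')`, nowhere defined if `(ν, ν')` is not an edge. -/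
noncomputable def stepC {E : CyclicSystem.{u, v}} (P : PreProof E) (ν ν' : P.Node) (τ τ' : E.TC) :
    Option Ordinal.{v} :=
  if h : P.Edge ν ν' then E.δC (P.rule ν) (P.inst ν) (P.premise ν ν' h) τ τ' else none

/-- Global soundness: every infinite path has a tail that is followed by an infinitely progressing
left-hand trace. -/
def IsCyclicProof {E : CyclicSystem.{u, v}} (P : PreProof E) : Prop :=
  ∀ p : ℕ → P.Node, (∀ i, P.Edge (p i) (p (i + 1))) →
    ∃ (k : ℕ) (t : ℕ → E.TA),
      (∀ i, (P.stepA (p (k + i)) (p (k + i + 1)) (t i) (t (i + 1))).isSome) ∧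
      ∀ j, ∃ i ≥ j, ∃ α > 0, P.stepA (p (k + i)) (p (k + i + 1)) (t i) (t (i + 1)) = some α

/-- The right-hand trace value `τ` is terminal for `ν`. -/
def Terminal {E : CyclicSystem.{u, v}} (P : PreProof E) (ν : P.Node) (τ : E.TC) : Prop :=
  ∀ ν', P.Edge ν ν' → ∀ τ', P.stepC ν ν' τ τ' = none

/-- `t 0, …, t n` is a positive maximal right-hand trace following `p 0, …, p n`. -/
def IsPositiveMaximal {E : CyclicSystem.{u, v}} {O : OrdinalTraceFunction E} (P : PreProof E)
    (X : ExclusionPredicate O) (p : ℕ → P.Node) (t : ℕ → E.TC) (n : ℕ) : Prop :=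
  Trace.Follows P.stepC p t n ∧ P.Terminal (p n) (t n) ∧ ¬ X.excludes (P.inst (p n)) (t n)

/-- The trace value ordering relation between `τ₂` (consequent) and `τ₁` (antecedent) at `ν`, where
sizes of traces are compared by `rel`. -/
def TraceOrder {E : CyclicSystem.{u, v}} {O : OrdinalTraceFunction E} (P : PreProof E)
    (X : ExclusionPredicate O) (rel : Ordinal.{v} → Ordinal.{v} → Prop) (ν : P.Node)
    (τ₂ : E.TC) (τ₁ : E.TA) : Prop :=
  ∀ (n : ℕ) (p : ℕ → P.Node) (t : ℕ → E.TC), p 0 = ν → t 0 = τ₂ → P.IsPositiveMaximal X p t n →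
    ∃ k ≤ n, ∃ t' : ℕ → E.TA, t' 0 = τ₁ ∧ Trace.Follows P.stepA p t' k ∧
      rel (Trace.size P.stepC p t n) (Trace.size P.stepA p t' k) ∧
      (O.Ground (P.seq (p n)) (t n) ∨
        (P.Axiomatic (p n) ∧ k = n ∧ O.Equates (P.seq (p n)) (t' n) (t n)))

def TraceLE {E : CyclicSystem.{u, v}} {O : OrdinalTraceFunction E} (P : PreProof E)
    (X : ExclusionPredicate O) (ν : P.Node) (τ₂ : E.TC) (τ₁ : E.TA) : Prop :=
  P.TraceOrder X (· ≤ ·) ν τ₂ τ₁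

def TraceLT {E : CyclicSystem.{u, v}} {O : OrdinalTraceFunction E} (P : PreProof E)
    (X : ExclusionPredicate O) (ν : P.Node) (τ₂ : E.TC) (τ₁ : E.TA) : Prop :=
  P.TraceOrder X (· < ·) ν τ₂ τ₁

/-! ### The three restrictions and the constants -/

def FinitelyProgressing {E : CyclicSystem.{u, v}} (P : PreProof E) (ν : P.Node) (τ : E.TA) (τ' : E.TC) :
    Prop :=
  Trace.FinitelyProgressing P.stepA ν τ ∧ Trace.FinitelyProgressing P.stepC ν τ'

def Dynamic {E : CyclicSystem.{u, v}} (P : PreProof E) (ν : P.Node) (τ : E.TA) (τ' : E.TC) : Prop :=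
  Trace.Dynamic P.stepA ν τ ∧ Trace.Dynamic P.stepC ν τ'

def Balanced {E : CyclicSystem.{u, v}} (P : PreProof E) (ν : P.Node) (τ : E.TA) : Prop :=
  Trace.Balanced P.stepA ν τ

/-- The trace width. -/
def width {E : CyclicSystem.{u, v}} (P : PreProof E) : ℕ :=
  Finset.univ.sup fun ν => max (P.valsA ν).card (P.valsC ν).card

/-- The cycle threshold: the number of triples `(τ, τ', ν)` of a node and two of its left-hand trace
values. -/
def threshold {E : CyclicSystem.{u, v}} (P : PreProof E) : ℕ :=
  ∑ ν, (P.valsA ν ×ˢ P.valsA ν).card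

/-- The largest (the set is finite) ordinal assigned to a left-hand trace pair `(τ', τ'')` for an
edge `(ν', ν'')` such that `(ν', τ')` is reachable from `(ν, τ)`; it is `0` if there are none. -/
noncomputable def maxStep {E : CyclicSystem.{u, v}} (P : PreProof E) (ν : P.Node) (τ : E.TA) :
    Ordinal.{v} :=
  sSup {α | ∃ ν' ν'' τ' τ'', Trace.Reachable P.stepA ν τ ν' τ' ∧ P.stepA ν' ν'' τ' τ'' = some α}

end PreProof

/-! ### Weighted automata over the ordinal max-plus semiring -/

/-- A weighted automaton with weights in the ordinals with a least element `⊥` adjoined. In the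
max-plus semiring, the product of `α` and `β` is `β + α`, with absorbing element `⊥`. -/
structure WeightedAutomaton (L : Type u) where
  State : Type u
  [finiteState : Finite State]
  init : State
  final : Set State
  trans : State → L → State → Prop
  weight : State → L → State → WithBot Ordinal.{v}

attribute [instance] WeightedAutomaton.finiteState

namespace WeightedAutomaton

/-- The runs over a word. -/
def Run {L : Type u} (A : WeightedAutomaton.{u, v} L) (w : List L) : Type u :=
  {q : Fin (w.length + 1) → A.State //
    q 0 = A.init ∧ ∀ i : Fin w.length, A.trans (q i.castSucc) (w.get i) (q i.succ)}

open Classical in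
/-- The value of a run. The sum is the semiring product of the weights in the order of the word. -/
noncomputable def value {L : Type u} (A : WeightedAutomaton.{u, v} L) {w : List L} (ρ : A.Run w) :
    WithBot Ordinal.{v} :=
  if ρ.1 (Fin.last _) ∈ A.final then
    (List.ofFn fun i : Fin w.length =>
      A.weight (ρ.1 i.castSucc) (w.get i) (ρ.1 i.succ)).reverse.sum
  else ⊥

/-- The set of values of runs over a word. -/
def values {L : Type u} (A : WeightedAutomaton.{u, v} L) (w : List L) : Set (WithBot Ordinal.{v}) :=
  Set.range fun ρ : A.Run w => A.value ρ

instance {L : Type u} (A : WeightedAutomaton.{u, v} L) (w : List L) : Finite (A.Run w) :=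
  inferInstanceAs (Finite (Subtype _))

theorem values_finite {L : Type u} (A : WeightedAutomaton.{u, v} L) (w : List L) : (A.values w).Finite :=
  Set.finite_range _

/-- The quantitative language: the maximum of the values of the runs over a word, `⊥` if there is no
run. -/
noncomputable def lang {L : Type u} (A : WeightedAutomaton.{u, v} L) (w : List L) : WithBot Ordinal.{v} :=
  (A.values_finite w).toFinset.sup id

def LangLE {L : Type u} (A B : WeightedAutomaton.{u, v} L) : Prop := ∀ w, A.lang w ≤ B.lang w

def LangLT {L : Type u} (A B : WeightedAutomaton.{u, v} L) : Prop :=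
  ∀ w, A.lang w ≠ ⊥ → A.lang w < B.lang w

def Reachable {L : Type u} (A : WeightedAutomaton.{u, v} L) (q : A.State) : Prop :=
  ∃ w, ∃ ρ : A.Run w, ρ.1 (Fin.last _) = q

/-- The number of runs over a word is bounded. -/
def FinitelyAmbiguous {L : Type u} (A : WeightedAutomaton.{u, v} L) : Prop :=
  ∃ b : ℕ, ∀ w, Nat.card (A.Run w) ≤ b

end WeightedAutomaton

/-! ### The automata of a pre-proof -/

namespace PreProof

/-- The antecedent trace values occurring in the pre-proof. -/
abbrev AllA {E : CyclicSystem.{u, v}} (P : PreProof E) := {τ : E.TA // ∃ ν, τ ∈ P.valsA ν}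

/-- The consequent trace values occurring in the pre-proof. -/
abbrev AllC {E : CyclicSystem.{u, v}} (P : PreProof E) := {τ : E.TC // ∃ ν, τ ∈ P.valsC ν}

instance {E : CyclicSystem.{u, v}} (P : PreProof E) : Finite P.AllA :=
  ((Set.finite_iUnion fun ν => (P.valsA ν).finite_toSet).subset
    fun _ (h : ∃ ν, _ ∈ P.valsA ν) => Set.mem_iUnion.2 h).to_subtype

instance {E : CyclicSystem.{u, v}} (P : PreProof E) : Finite P.AllC :=
  ((Set.finite_iUnion fun ν => (P.valsC ν).finite_toSet).subset
    fun _ (h : ∃ ν, _ ∈ P.valsC ν) => Set.mem_iUnion.2 h).to_subtype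

/-- The alphabet: nodes, and pairs of a set of antecedent trace values and a consequent one. -/
abbrev Letter {E : CyclicSystem.{u, v}} (P : PreProof E) := P.Node ⊕ (Set P.AllA × P.AllC)

/-- The antecedent trace values of `ν` that the sequent of `ν` equates with `τ`. -/
def equated {E : CyclicSystem.{u, v}} (P : PreProof E) (O : OrdinalTraceFunction E) (ν : P.Node)
    (τ : E.TC) : Set P.AllA :=
  {τ' | τ'.1 ∈ P.valsA ν ∧ O.Equates (P.seq ν) τ'.1 τ}

/-- States of the automaton `B`. -/
inductive StateB {E : CyclicSystem.{u, v}} (P : PreProof E)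
  | init
  | bot
  | pair (ν : P.Node) (τ : P.AllC)

/-- States of the `n`-th approximate automaton; `top ν i` is the sink `⊤` with subscript `ν` and
superscript `i + 1`. -/
inductive StateA {E : CyclicSystem.{u, v}} (P : PreProof E) (n : ℕ)
  | init
  | bot
  | pair (ν : P.Node) (τ : P.AllA)
  | top (ν : P.Node) (i : Fin n)

instance {E : CyclicSystem.{u, v}} (P : PreProof E) : Finite P.StateB :=
  Finite.of_surjective
    (fun x : (Unit ⊕ Unit) ⊕ (P.Node × P.AllC) => match x with
      | .inl (.inl _) => StateB.init
      | .inl (.inr _) => StateB.bot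
      | .inr (ν, τ) => StateB.pair ν τ)
    (by
      rintro (_ | _ | ⟨ν, τ⟩)
      · exact ⟨.inl (.inl ()), rfl⟩
      · exact ⟨.inl (.inr ()), rfl⟩
      · exact ⟨.inr (ν, τ), rfl⟩)

instance {E : CyclicSystem.{u, v}} (P : PreProof E) (n : ℕ) : Finite (P.StateA n) :=
  Finite.of_surjective
    (fun x : (Unit ⊕ Unit) ⊕ ((P.Node × P.AllA) ⊕ (P.Node × Fin n)) => match x with
      | .inl (.inl _) => StateA.init
      | .inl (.inr _) => StateA.bot
      | .inr (.inl (ν, τ)) => StateA.pair ν τ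
      | .inr (.inr (ν, i)) => StateA.top ν i)
    (by
      rintro (_ | _ | ⟨ν, τ⟩ | ⟨ν, i⟩)
      · exact ⟨.inl (.inl ()), rfl⟩
      · exact ⟨.inl (.inr ()), rfl⟩
      · exact ⟨.inr (.inl (ν, τ)), rfl⟩
      · exact ⟨.inr (.inr (ν, i)), rfl⟩)

/-- Final states of `B`. -/
def FinalB {E : CyclicSystem.{u, v}} {O : OrdinalTraceFunction E} (P : PreProof E)
    (X : ExclusionPredicate O) : P.StateB → Prop
  | .init => False
  | .bot => True
  | .pair ν τ =>
      (¬ P.Axiomatic ν ∧ P.Terminal ν τ.1 ∧ ¬ X.excludes (P.inst ν) τ.1) ∨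
      (P.Axiomatic ν ∧ O.Ground (P.seq ν) τ.1 ∧ ¬ X.excludes (P.inst ν) τ.1)

/-- Transitions of `B`. -/
inductive TransB {E : CyclicSystem.{u, v}} {O : OrdinalTraceFunction E} (P : PreProof E)
    (X : ExclusionPredicate O) (ν₀ : P.Node) (τ₂ : E.TC) : P.StateB → P.Letter → P.StateB → Prop
  | init (τ : P.AllC) (h : τ.1 = τ₂) : TransB P X ν₀ τ₂ .init (.inl ν₀) (.pair ν₀ τ)
  | step (ν ν' : P.Node) (τ τ' : P.AllC) (h : P.Edge ν ν')
      (hd : (P.stepC ν ν' τ.1 τ'.1).isSome) :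
      TransB P X ν₀ τ₂ (.pair ν τ) (.inl ν') (.pair ν' τ')
  | equate (ν : P.Node) (τ : P.AllC) (hτ : τ.1 ∈ P.valsC ν) (ha : P.Axiomatic ν)
      (hg : ¬ O.Ground (P.seq ν) τ.1) (he : ¬ X.excludes (P.inst ν) τ.1) :
      TransB P X ν₀ τ₂ (.pair ν τ) (.inr (P.equated O ν τ.1, τ)) .bot

/-- Transitions of the `n`-th approximate automaton. -/
inductive TransA {E : CyclicSystem.{u, v}} (P : PreProof E) (O : OrdinalTraceFunction E)
    (n : ℕ) (ν₀ : P.Node) (τ₁ : E.TA) : P.StateA n → P.Letter → P.StateA n → Prop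
  | init (τ : P.AllA) (h : τ.1 = τ₁) : TransA P O n ν₀ τ₁ .init (.inl ν₀) (.pair ν₀ τ)
  | step (ν ν' : P.Node) (τ τ' : P.AllA) (h : P.Edge ν ν')
      (hd : (P.stepA ν ν' τ.1 τ'.1).isSome) :
      TransA P O n ν₀ τ₁ (.pair ν τ) (.inl ν') (.pair ν' τ')
  | equate (ν : P.Node) (τ : P.AllA) (τ' : P.AllC) (ha : P.Axiomatic ν) (hτ' : τ'.1 ∈ P.valsC ν)
      (hτ : τ ∈ P.equated O ν τ'.1) :
      TransA P O n ν₀ τ₁ (.pair ν τ) (.inr (P.equated O ν τ'.1, τ')) .bot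
  | enter (ν ν' : P.Node) (τ : P.AllA) (h : P.Edge ν ν') (hn : 0 < n) :
      TransA P O n ν₀ τ₁ (.pair ν τ) (.inl ν') (.top ν' ⟨0, hn⟩)
  | stay (ν ν' : P.Node) (i : Fin n) (h : ν' ≠ ν) :
      TransA P O n ν₀ τ₁ (.top ν i) (.inl ν') (.top ν i)
  | count (ν : P.Node) (i : ℕ) (hi : i + 1 < n) :
      TransA P O n ν₀ τ₁ (.top ν ⟨i, Nat.lt_of_succ_lt hi⟩) (.inl ν) (.top ν ⟨i + 1, hi⟩)

noncomputable def weightB {E : CyclicSystem.{u, v}} (P : PreProof E) :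
    P.StateB → P.Letter → P.StateB → WithBot Ordinal.{v}
  | .pair ν τ, _, .pair ν' τ' => (((P.stepC ν ν' τ.1 τ'.1).getD 0 : Ordinal.{v}) : WithBot Ordinal.{v})
  | _, _, _ => 0

noncomputable def weightA {E : CyclicSystem.{u, v}} (P : PreProof E) (n : ℕ) :
    P.StateA n → P.Letter → P.StateA n → WithBot Ordinal.{v}
  | .pair ν τ, _, .pair ν' τ' => (((P.stepA ν ν' τ.1 τ'.1).getD 0 : Ordinal.{v}) : WithBot Ordinal.{v})
  | _, _, _ => 0

/-- The right-hand trace automaton for the initial node `ν₀` and consequent trace value `τ₂`. -/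
noncomputable def autB {E : CyclicSystem.{u, v}} {O : OrdinalTraceFunction E} (P : PreProof E)
    (X : ExclusionPredicate O) (ν₀ : P.Node) (τ₂ : E.TC) : WeightedAutomaton.{u, v} P.Letter where
  State := P.StateB
  init := .init
  final := {q | P.FinalB X q}
  trans := P.TransB X ν₀ τ₂
  weight := P.weightB

/-- The `n`-th approximate left-hand trace automaton for the initial node `ν₀` and antecedent trace
value `τ₁`. -/
noncomputable def autA {E : CyclicSystem.{u, v}} (P : PreProof E) (O : OrdinalTraceFunction E)
    (n : ℕ) (ν₀ : P.Node) (τ₁ : E.TA) : WeightedAutomaton.{u, v} P.Letter where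
  State := P.StateA n
  init := .init
  final := {q | q ≠ .init}
  trans := P.TransA O n ν₀ τ₁
  weight := P.weightA n

/-- `B` is grounded. -/
def GroundedB {E : CyclicSystem.{u, v}} {O : OrdinalTraceFunction E} (P : PreProof E)
    (X : ExclusionPredicate O) (ν₀ : P.Node) (τ₂ : E.TC) : Prop :=
  ∀ (ν : P.Node) (τ : P.AllC), P.FinalB X (.pair ν τ) →
    (P.autB X ν₀ τ₂).Reachable (StateB.pair ν τ) → O.Ground (P.seq ν) τ.1

end PreProof

/-!
A run of the right-hand automaton is a right-hand trace along the path that it reads, and its value is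
the size of the trace. A run of the approximate left-hand automaton is a left-hand trace along an
initial part of the path; the trace is given up by moving to a sink, which remembers the next node and
tolerates a bounded number of its occurrences (`traceOfB`, `traceOfA` and the lemmas `runB_pair`,
`runB_bot`, `runA_pair`, `runA_bot`, `runA_top`). So language inclusion yields the trace ordering
(`traceOrder_of_lang`). Conversely, the trace ordering provides for each maximal run of the right-hand
automaton a left-hand trace of sufficient size, and only one thing may go wrong: the node at which this
trace `t'` is given up may recur too often in the rest of the path.

In that case (`exists_trace_of_recurrence`) the recurring node also recurs with the same right-hand
trace value, even close to the end of the path. As the right-hand cycles have positive size, repeating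
this right-hand cycle often enough gives a right-hand trace larger than any left-hand trace that ends
before the cycle. The trace ordering, applied to it, provides a left-hand trace `u` that reaches the
cycle, hence follows the original path up to that point. When `t'` is given up, `u` is smaller by at
most the number of triples (node, value, value) times the largest step: the system is balanced, so
deleting simple binary cycles from the pair of traces does not change the difference of their sizes
(`weight_le_weight_add_of_balanced`). On the way to the cycle, `u` passes through the recurring node so
often that its own cycles, all of positive size, make up for this (`weight_add_le_of_visits`). Thus `u`
is at least as large as `t'`, and it may be given up just before the cycle, where the node recurs only
a few more times. All sizes involved are finite, so the argument uses natural numbers.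

For trace injective systems, transitions can be retraced backwards, except for those that leave the
part of a run that follows a trace. So a run is determined by its last state and the last state of that
part, whatever the word (`finitelyAmbiguous_autA`).
-/

/-! ### Walks in a weighted graph -/

namespace StateWalk

variable {S : Type*}

/-- The first `n + 1` entries of `s` form a walk of `n` steps along the relation `R`. -/
def IsWalk (R : S → S → Prop) (s : ℕ → S) (n : ℕ) : Prop := ∀ i < n, R (s i) (s (i + 1))

/-- The total weight of the first `n` steps of `s`. -/
def weight {M : Type*} [AddCommMonoid M] (w : S → S → M) (s : ℕ → S) (n : ℕ) : M :=
  ∑ i ∈ Finset.range n, w (s i) (s (i + 1))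

/-- Follow `s` up to position `a`, then continue from position `b`. If `s a = s b`, this deletes the
cycle between `a` and `b` when `a < b`, and repeats it when `b < a`. -/
def splice (s : ℕ → S) (a b : ℕ) (x : ℕ) : S := if x ≤ a then s x else s (b + (x - a))

/-- The first `n` steps of `s` form a cycle without repetitions, except for its two ends. -/
def IsSimpleCycle (s : ℕ → S) (n : ℕ) : Prop :=
  0 < n ∧ s 0 = s n ∧ ∀ i j, 0 < i → i < j → j ≤ n → s i ≠ s j

theorem splice_of_le (s : ℕ → S) {a x : ℕ} (b : ℕ) (h : x ≤ a) : splice s a b x = s x := if_pos h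

theorem splice_add {s : ℕ → S} {a b : ℕ} (h : s a = s b) (x : ℕ) :
    splice s a b (a + x) = s (b + x) := by
  rcases Nat.eq_zero_or_pos x with rfl | hx
  · simpa [splice] using h
  · simp [splice, hx.ne']

theorem IsWalk.shift {R : S → S → Prop} {s : ℕ → S} {a m n : ℕ} (h : IsWalk R s n)
    (hm : a + m ≤ n) : IsWalk R (fun x => s (a + x)) m :=
  fun i hi => h (a + i) (by omega)

theorem IsWalk.splice {R : S → S → Prop} {s : ℕ → S} {a b c n : ℕ} (h : IsWalk R s n)
    (hab : s a = s b) (ha : a ≤ n) (hc : b + c ≤ n) : IsWalk R (splice s a b) (a + c) := by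
  intro i hi
  rcases lt_or_ge i a with hia | hia
  · rw [splice_of_le _ _ hia.le, splice_of_le _ _ hia]
    exact h i (by omega)
  · obtain ⟨x, rfl⟩ := Nat.exists_eq_add_of_le hia
    rw [splice_add hab, add_assoc, splice_add hab]
    exact h (b + x) (by omega)

theorem weight_congr {M : Type*} [AddCommMonoid M] {w : S → S → M} {s s' : ℕ → S} {n : ℕ}
    (h : ∀ x ≤ n, s x = s' x) : weight w s n = weight w s' n := by
  refine Finset.sum_congr rfl fun i hi => ?_
  have := Finset.mem_range.1 hi
  rw [h i this.le, h (i + 1) this]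

theorem weight_add {M : Type*} [AddCommMonoid M] (w : S → S → M) (s : ℕ → S) (a c : ℕ) :
    weight w s (a + c) = weight w s a + weight w (fun x => s (a + x)) c :=
  Finset.sum_range_add _ _ _

theorem weight_splice {M : Type*} [AddCommMonoid M] (w : S → S → M) {s : ℕ → S} {a b : ℕ}
    (hab : s a = s b) (c : ℕ) :
    weight w (splice s a b) (a + c) = weight w s a + weight w (fun x => s (b + x)) c := by
  rw [weight_add]
  congr 1
  · exact weight_congr fun x hx => splice_of_le _ _ hx
  · exact weight_congr fun x _ => splice_add hab x

theorem weight_mono (w : S → S → ℕ) (s : ℕ → S) : Monotone (weight w s) := fun _ _ h =>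
  Finset.sum_le_sum_of_subset (Finset.range_mono h)

theorem weight_le {w : S → S → ℤ} {s : ℕ → S} {n : ℕ} {m : ℤ}
    (h : ∀ i < n, w (s i) (s (i + 1)) ≤ m) : weight w s n ≤ n * m := by
  simpa [weight] using Finset.sum_le_card_nsmul (Finset.range n) _ m
    fun i hi => h i (Finset.mem_range.1 hi)

/-- A shortest repetition between two positions is a simple cycle. -/
theorem exists_isSimpleCycle {s : ℕ → S} {i j : ℕ} (hij : i < j) (h : s i = s j) :
    ∃ a m, i ≤ a ∧ a + m ≤ j ∧ IsSimpleCycle (fun x => s (a + x)) m := by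
  induction hd : j - i using Nat.strong_induction_on generalizing i j with
  | _ d ih =>
    by_cases hs : ∃ x y, i < x ∧ x < y ∧ y ≤ j ∧ s x = s y
    · obtain ⟨x, y, hx, hxy, hy, hs⟩ := hs
      obtain ⟨a, m, h₁, h₂, h₃⟩ := ih (y - x) (by omega) hxy hs rfl
      exact ⟨a, m, by omega, by omega, h₃⟩
    · push Not at hs
      refine ⟨i, j - i, le_rfl, by omega, by omega, ?_, fun x y hx hxy hy => ?_⟩
      · simpa [Nat.add_sub_cancel' hij.le] using h
      · exact hs _ _ (by omega) (by omega) (by omega)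

/-- If simple cycles have positive weight, so have all cycles. -/
theorem weight_lt_of_repeat {R : S → S → Prop} {w : S → S → ℕ}
    (hcyc : ∀ s n, IsWalk R s n → IsSimpleCycle s n → 0 < weight w s n)
    {s : ℕ → S} {i j n : ℕ} (hs : IsWalk R s n) (hij : i < j) (hj : j ≤ n) (h : s i = s j) :
    weight w s i < weight w s j := by
  obtain ⟨a, m, h₁, h₂, h₃⟩ := exists_isSimpleCycle hij h
  have hpos := hcyc _ _ (hs.shift (h₂.trans hj)) h₃
  calc weight w s i ≤ weight w s a := weight_mono w s h₁
    _ < weight w s (a + m) := by rw [weight_add]; omega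
    _ ≤ weight w s j := weight_mono w s h₂

/-- If simple cycles have weight zero, then deleting them bounds the weight of any walk by that of
a walk that visits each state at most once. -/
theorem weight_le_of_cycles_zero {R : S → S → Prop} {w : S → S → ℤ} {F : Finset S} {m : ℕ}
    (hF : ∀ x y, R x y → x ∈ F ∧ y ∈ F) (hw : ∀ x y, R x y → w x y ≤ m)
    (hcyc : ∀ s n, IsWalk R s n → IsSimpleCycle s n → weight w s n = 0)
    (n : ℕ) (s : ℕ → S) (hs : IsWalk R s n) : weight w s n ≤ F.card * m := by
  induction n using Nat.strong_induction_on generalizing s with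
  | _ n ih =>
    rcases le_or_gt n F.card with hn | hn
    · refine (weight_le fun i hi => hw _ _ (hs i hi)).trans ?_
      gcongr
    · have hmaps : Set.MapsTo s (Finset.range n) F := fun x hx =>
        (hF _ _ (hs x (by simpa using hx))).1
      obtain ⟨i, hi, j, hj, hne, heq⟩ :=
        Finset.exists_ne_map_eq_of_card_lt_of_maps_to (by simpa using hn) hmaps
      have key : ∀ i j, i < j → j < n → s i = s j → weight w s n ≤ F.card * m := by
        intro i j hij hj heq
        -- Delete a simple cycle of weight zero.
        obtain ⟨a, l, h₁, h₂, h₃⟩ := exists_isSimpleCycle hij heq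
        have h0 := hcyc _ _ (hs.shift (h₂.trans hj.le)) h₃
        have hl := h₃.1
        have hab : s a = s (a + l) := h₃.2.1
        obtain ⟨c, rfl⟩ := Nat.exists_eq_add_of_le (h₂.trans hj.le)
        have := ih (a + c) (by omega) _ (hs.splice hab (by omega) le_rfl)
        rwa [weight_splice w hab, ← add_zero (weight w s a), ← h0, ← weight_add,
          ← weight_add] at this
      rcases lt_or_gt_of_ne hne with h | h
      · exact key i j h (by simpa using hj) heq
      · exact key j i h (by simpa using hi) heq.symm

/-- A walk with a repetition can be extended, by going around the cycle repeatedly, to a walk with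
the same ends and arbitrarily large weight. -/
theorem exists_pumped {R : S → S → Prop} {w : S → S → ℕ}
    (hcyc : ∀ s n, IsWalk R s n → IsSimpleCycle s n → 0 < weight w s n)
    {s : ℕ → S} {i j n : ℕ} (hs : IsWalk R s n) (hij : i < j) (hj : j ≤ n) (h : s i = s j)
    (r : ℕ) :
    ∃ n' s', IsWalk R s' n' ∧ j ≤ n' ∧ (∀ x ≤ j, s' x = s x) ∧ s' n' = s n ∧
      r ≤ weight w s' n' := by
  induction r with
  | zero => exact ⟨n, s, hs, hj, fun _ _ => rfl, rfl, Nat.zero_le _⟩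
  | succ r ih =>
    obtain ⟨n', s', hs', hj', hpre, hend, hr⟩ := ih
    have h' : s' j = s' i := by rw [hpre j le_rfl, hpre i hij.le, h]
    have hlt := weight_lt_of_repeat hcyc hs' hij hj' h'.symm
    obtain ⟨c, rfl⟩ := Nat.exists_eq_add_of_le (hij.le.trans hj')
    refine ⟨j + c, splice s' j i, hs'.splice h' hj' le_rfl, by omega,
      fun x hx => (splice_of_le _ _ hx).trans (hpre x hx), (splice_add h' c).trans hend, ?_⟩
    rw [weight_splice w h']
    rw [weight_add] at hr
    omega

/-- A walk that meets a set of at most `W` states more than `m * W` times gains weight at least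
`m`: the visits are told apart by the weight before them and the state visited. -/
theorem weight_add_le_of_visits {R : S → S → Prop} {w : S → S → ℕ}
    (hcyc : ∀ s n, IsWalk R s n → IsSimpleCycle s n → 0 < weight w s n)
    {s : ℕ → S} {n a b m W : ℕ} (hs : IsWalk R s n) (hb : b ≤ n) {F : Finset S} (hF : F.card ≤ W)
    {V : Finset ℕ} (hV : ∀ x ∈ V, a ≤ x ∧ x ≤ b ∧ s x ∈ F) (hcard : m * W < V.card) :
    weight w s a + m ≤ weight w s b := by
  by_contra! hlt
  have hmaps : Set.MapsTo (fun x => (weight w s x, s x)) V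
      (Finset.Ico (weight w s a) (weight w s a + m) ×ˢ F : Finset _) := by
    intro x hx
    obtain ⟨h₁, h₂, h₃⟩ := hV x hx
    simp only [Finset.coe_product, Set.mem_prod, Finset.mem_coe, Finset.mem_Ico]
    exact ⟨⟨weight_mono w s h₁, (weight_mono w s h₂).trans_lt hlt⟩, h₃⟩
  have hinj : Set.InjOn (fun x => (weight w s x, s x)) V := by
    have key : ∀ x ∈ V, ∀ y ∈ V, s x = s y → weight w s x = weight w s y → ¬ x < y :=
      fun x _ y hy h h' hxy =>
        (weight_lt_of_repeat hcyc hs hxy ((hV y hy).2.1.trans hb) h).ne h'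
    intro x hx y hy hxy
    obtain ⟨h₁, h₂⟩ := Prod.mk.inj hxy
    exact le_antisymm (not_lt.1 (key y hy x hx h₂.symm h₁.symm)) (not_lt.1 (key x hx y hy h₂ h₁))
  have := Finset.card_le_card_of_injOn _ hmaps hinj
  rw [Finset.card_product, Nat.card_Ico, Nat.add_sub_cancel_left] at this
  exact absurd (this.trans (Nat.mul_le_mul_left m hF)) (not_le.2 hcard)

end StateWalk

/-! ### Traces with finite steps -/

theorem revSum_congr {a b : ℕ → Ordinal.{v}} {n : ℕ} (h : ∀ i < n, a i = b i) :
    revSum a n = revSum b n := by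
  induction n with
  | zero => rfl
  | succ n ih =>
    rw [revSum, revSum, h n n.lt_succ_self, ih fun i hi => h i (hi.trans n.lt_succ_self)]

theorem revSum_natCast (a : ℕ → ℕ) (n : ℕ) :
    revSum (fun i => (a i : Ordinal.{v})) n = ((∑ i ∈ Finset.range n, a i : ℕ) : Ordinal.{v}) := by
  induction n with
  | zero => simp [revSum]
  | succ n ih => rw [revSum, ih, Finset.sum_range_succ, add_comm (∑ i ∈ _, _), Nat.cast_add]

namespace Trace

open StateWalk

variable {N T : Type*} {d : N → N → T → T → Option Ordinal.{v}} {ν₀ : N} {τ₀ : T}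

theorem Follows.mono {p : ℕ → N} {t : ℕ → T} {m n : ℕ} (h : Follows d p t n) (hm : m ≤ n) :
    Follows d p t m := fun i hi => h i (hi.trans_le hm)

theorem Follows.congr {p p' : ℕ → N} {t t' : ℕ → T} {n : ℕ} (h : Follows d p t n)
    (hp : ∀ x ≤ n, p x = p' x) (ht : ∀ x ≤ n, t x = t' x) : Follows d p' t' n := by
  intro i hi
  rw [← hp i hi.le, ← hp (i + 1) hi, ← ht i hi.le, ← ht (i + 1) hi]
  exact h i hi

theorem size_congr {p p' : ℕ → N} {t t' : ℕ → T} {n : ℕ}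
    (hp : ∀ x ≤ n, p x = p' x) (ht : ∀ x ≤ n, t x = t' x) : size d p t n = size d p' t' n := by
  refine revSum_congr fun i hi => ?_
  rw [hp i hi.le, hp (i + 1) hi, ht i hi.le, ht (i + 1) hi]

/-- The value of a trace pair as a natural number; meaningful if that value is finite. -/
noncomputable def natStep (d : N → N → T → T → Option Ordinal.{v}) (x y : N × T) : ℕ :=
  Cardinal.toNat ((d x.1 y.1 x.2 y.2).getD 0).card

/-- A trace pair starting at a pair that is reachable from `(ν₀, τ₀)`. -/
def ReachableStep (d : N → N → T → T → Option Ordinal.{v}) (ν₀ : N) (τ₀ : T) (x y : N × T) : Prop :=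
  Reachable d ν₀ τ₀ x.1 x.2 ∧ (d x.1 y.1 x.2 y.2).isSome

theorem natStep_cast (hfin : FinitelyProgressing d ν₀ τ₀) {x y : N × T}
    (h : Reachable d ν₀ τ₀ x.1 x.2) :
    (natStep d x y : Ordinal.{v}) = (d x.1 y.1 x.2 y.2).getD 0 := by
  rcases hd : d x.1 y.1 x.2 y.2 with _ | α
  · simp [natStep, hd]
  · obtain ⟨k, rfl⟩ := Ordinal.lt_omega0.1 (hfin _ _ _ _ _ h hd)
    simp [natStep, hd]

theorem Follows.isWalk {p : ℕ → N} {t : ℕ → T} {n : ℕ} (h : Follows d p t n)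
    (hp : p 0 = ν₀) (ht : t 0 = τ₀) :
    IsWalk (ReachableStep d ν₀ τ₀) (fun x => (p x, t x)) n :=
  fun i hi => ⟨⟨i, p, t, hp, ht, rfl, rfl, h.mono hi.le⟩, h i hi⟩

theorem follows_of_isWalk {s : ℕ → N × T} {n : ℕ} (h : IsWalk (ReachableStep d ν₀ τ₀) s n) :
    Follows d (fun x => (s x).1) (fun x => (s x).2) n := fun i hi => (h i hi).2

theorem size_eq_weight (hfin : FinitelyProgressing d ν₀ τ₀) {s : ℕ → N × T} {n : ℕ}
    (h : IsWalk (ReachableStep d ν₀ τ₀) s n) :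
    size d (fun x => (s x).1) (fun x => (s x).2) n = (weight (natStep d) s n : ℕ) := by
  rw [weight, ← revSum_natCast]
  exact revSum_congr fun i hi => (natStep_cast hfin (h i hi).1).symm

theorem weight_pos_of_dynamic (hfin : FinitelyProgressing d ν₀ τ₀) (hdyn : Dynamic d ν₀ τ₀)
    (s : ℕ → N × T) (n : ℕ) (hs : IsWalk (ReachableStep d ν₀ τ₀) s n) (hc : StateWalk.IsSimpleCycle s n) :
    0 < weight (natStep d) s n := by
  obtain ⟨hn, hc, hsimple⟩ := hc
  have := hdyn n _ _ ⟨⟨hn, follows_of_isWalk hs, congrArg Prod.fst hc, congrArg Prod.snd hc⟩,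
    fun i j hi hij hj h => hsimple i j hi hij hj (Prod.ext h.1 h.2)⟩ (hs 0 hn).1
  rw [size_eq_weight hfin hs] at this
  exact_mod_cast this

/-- In a balanced system, two traces along the same path differ in size by at most the number of
triples of a node and two values, times the largest step. -/
theorem weight_le_weight_add_of_balanced (hfin : FinitelyProgressing d ν₀ τ₀)
    (hbal : Balanced d ν₀ τ₀) {F : Finset (N × T × T)} {m : ℕ}
    (hm : ∀ x y, ReachableStep d ν₀ τ₀ x y → natStep d x y ≤ m)
    (hF : ∀ ν ν' τ₁ τ₁' τ₂ τ₂', (d ν ν' τ₁ τ₁').isSome → (d ν ν' τ₂ τ₂').isSome →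
      (ν, τ₁, τ₂) ∈ F ∧ (ν', τ₁', τ₂') ∈ F)
    {p : ℕ → N} {t t' : ℕ → T} {n : ℕ} (hp : p 0 = ν₀) (ht : t 0 = τ₀) (ht' : t' 0 = τ₀)
    (h : Follows d p t n) (h' : Follows d p t' n) :
    weight (natStep d) (fun x => (p x, t x)) n ≤
      weight (natStep d) (fun x => (p x, t' x)) n + F.card * m := by
  let w : N × T × T → N × T × T → ℤ := fun x y =>
    natStep d (x.1, x.2.1) (y.1, y.2.1) - natStep d (x.1, x.2.2) (y.1, y.2.2)
  let R : N × T × T → N × T × T → Prop := fun x y =>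
    ReachableStep d ν₀ τ₀ (x.1, x.2.1) (y.1, y.2.1) ∧
      ReachableStep d ν₀ τ₀ (x.1, x.2.2) (y.1, y.2.2)
  have hsub : ∀ (s : ℕ → N × T × T) (n : ℕ), weight w s n =
      ((weight (natStep d) (fun x => ((s x).1, (s x).2.1)) n : ℕ) : ℤ) -
        (weight (natStep d) (fun x => ((s x).1, (s x).2.2)) n : ℕ) := by
    intro s n
    simp [weight, w]
  have hcyc : ∀ s n, IsWalk R s n → StateWalk.IsSimpleCycle s n → weight w s n = 0 := by
    rintro s n hs ⟨hn, hc, hsimple⟩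
    have h₁ : IsWalk (ReachableStep d ν₀ τ₀) (fun x => ((s x).1, (s x).2.1)) n :=
      fun i hi => (hs i hi).1
    have h₂ : IsWalk (ReachableStep d ν₀ τ₀) (fun x => ((s x).1, (s x).2.2)) n :=
      fun i hi => (hs i hi).2
    have hc₁ : (s 0).1 = (s n).1 := by rw [hc]
    have := hbal n (fun x => (s x).1) (fun x => (s x).2.1) (fun x => (s x).2.2)
      ⟨⟨hn, follows_of_isWalk h₁, hc₁, by simp only [hc]⟩,
      ⟨hn, follows_of_isWalk h₂, hc₁, by simp only [hc]⟩, fun i j hi hij hj h =>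
        hsimple i j hi hij hj (Prod.ext h.1 (Prod.ext h.2.1 h.2.2))⟩ (h₁ 0 hn).1 (h₂ 0 hn).1
    rw [size_eq_weight hfin h₁, size_eq_weight hfin h₂, Nat.cast_inj] at this
    rw [hsub, this, sub_self]
  have := weight_le_of_cycles_zero (R := R) (w := w) (F := F) (m := m)
    (fun x y hxy => hF _ _ _ _ _ _ hxy.1.2 hxy.2.2)
    (fun x y hxy => by have := hm _ _ hxy.1; simp only [w]; omega) hcyc n
    (fun x => (p x, t x, t' x)) (fun i hi => ⟨h.isWalk hp ht i hi, h'.isWalk hp ht' i hi⟩)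
  rw [hsub] at this
  zify
  linarith

end Trace

/-! ### Runs of weighted automata -/

namespace WeightedAutomaton

variable {L : Type u} {A : WeightedAutomaton.{u, v} L} {ω : A.State → L → A.State → Ordinal.{v}}

/-- `Reaches A ω w q α`: some run over `w` ends in the state `q`, and its weights, given by the
function `ω`, sum up to `α`. -/
inductive Reaches (A : WeightedAutomaton.{u, v} L) (ω : A.State → L → A.State → Ordinal.{v}) :
    List L → A.State → Ordinal.{v} → Prop
  | nil : Reaches A ω [] A.init 0
  | snoc {w : List L} {q : A.State} {α : Ordinal.{v}} (h : Reaches A ω w q α) {a : L} {q' : A.State}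
      (ht : A.trans q a q') : Reaches A ω (w ++ [a]) q' (ω q a q' + α)

theorem sum_reverse_ofFn (g : ℕ → Ordinal.{v}) (n : ℕ) :
    (List.ofFn fun i : Fin n => (g i : WithBot Ordinal.{v})).reverse.sum = revSum g n := by
  induction n with
  | zero => simp [revSum]
  | succ n ih =>
    rw [List.ofFn_succ', List.concat_eq_append, List.reverse_append, List.reverse_singleton,
      List.singleton_append, List.sum_cons, revSum, WithBot.coe_add, ← ih]
    simp

/-- The states of a run as a sequence, continued arbitrarily. -/
def Run.states {w : List L} (ρ : A.Run w) (i : ℕ) : A.State :=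
  if h : i < w.length + 1 then ρ.1 ⟨i, h⟩ else A.init

theorem Run.states_eq {w : List L} (ρ : A.Run w) (i : Fin (w.length + 1)) :
    ρ.states i = ρ.1 i := dif_pos i.2

theorem Run.states_zero {w : List L} (ρ : A.Run w) : ρ.states 0 = A.init :=
  (ρ.states_eq 0).trans ρ.2.1

theorem Run.states_trans {w : List L} (ρ : A.Run w) {i : ℕ} (h : i < w.length) :
    A.trans (ρ.states i) w[i] (ρ.states (i + 1)) := by
  have := ρ.2.2 ⟨i, h⟩
  rwa [← ρ.states_eq, ← ρ.states_eq] at this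

theorem Run.states_length {w : List L} (ρ : A.Run w) :
    ρ.states w.length = ρ.1 (Fin.last _) := ρ.states_eq (Fin.last _)

/-- The sum of the weights of a run. -/
noncomputable def Run.total (ω : A.State → L → A.State → Ordinal.{v}) {w : List L} (ρ : A.Run w) :
    WithBot Ordinal.{v} :=
  (List.ofFn fun i : Fin w.length =>
    (ω (ρ.1 i.castSucc) (w.get i) (ρ.1 i.succ) : WithBot Ordinal.{v})).reverse.sum

theorem Run.total_eq {w : List L} (ρ : A.Run w) {g : ℕ → Ordinal.{v}}
    (hg : ∀ i : Fin w.length, g i = ω (ρ.1 i.castSucc) (w.get i) (ρ.1 i.succ)) :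
    ρ.total ω = (revSum g w.length : WithBot Ordinal.{v}) := by
  simp only [← sum_reverse_ofFn, Run.total, hg]

theorem Run.reaches (ω : A.State → L → A.State → Ordinal.{v}) {w : List L} (ρ : A.Run w) :
    ∃ α : Ordinal.{v}, ρ.total ω = α ∧ Reaches A ω w (ρ.1 (Fin.last _)) α := by
  classical
  -- The weights of the run, continued by zeros.
  let g : ℕ → Ordinal.{v} := fun i =>
    if h : i < w.length then ω (ρ.states i) w[i] (ρ.states (i + 1)) else 0
  have key : ∀ k ≤ w.length, Reaches A ω (w.take k) (ρ.states k) (revSum g k) := by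
    intro k
    induction k with
    | zero =>
      intro _
      rw [ρ.states_zero, List.take_zero]
      exact .nil
    | succ k ih =>
      intro hk
      have := (ih (by omega)).snoc (ρ.states_trans (i := k) hk)
      rw [List.take_append_getElem] at this
      simpa only [revSum, g, dif_pos (show k < w.length from hk)] using this
  refine ⟨revSum g w.length, ?_, ?_⟩
  · refine ρ.total_eq fun i => ?_
    simp only [g, dif_pos i.2]
    rw [← ρ.states_eq i.castSucc, ← ρ.states_eq i.succ]
    rfl
  · have := key w.length le_rfl
    rwa [List.take_length, ρ.states_length] at this

theorem Reaches.exists_run {w : List L} {q : A.State} {α : Ordinal.{v}} (h : Reaches A ω w q α) :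
    ∃ ρ : A.Run w, ρ.1 (Fin.last _) = q ∧ ρ.total ω = α := by
  suffices H : ∃ s : ℕ → A.State, s 0 = A.init ∧ s w.length = q ∧
      (∀ i (hi : i < w.length), A.trans (s i) w[i] (s (i + 1))) ∧
      ∀ g : ℕ → Ordinal.{v}, (∀ i (hi : i < w.length), g i = ω (s i) w[i] (s (i + 1))) →
        revSum g w.length = α by
    obtain ⟨s, h0, hl, ht, hg⟩ := H
    refine ⟨⟨fun i => s i, h0, fun i => ht i i.2⟩, hl, ?_⟩
    rw [← hg (fun i => if h : i < w.length then ω (s i) w[i] (s (i + 1)) else 0)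
      fun i hi => dif_pos hi]
    exact Run.total_eq _ fun i => dif_pos i.2
  induction h with
  | nil => exact ⟨fun _ => A.init, rfl, rfl, fun i hi => absurd hi (by simp), fun g _ => rfl⟩
  | @snoc w q α _ a q' ht ih =>
    obtain ⟨s, h0, hl, hs, hg⟩ := ih
    have hlen : (w ++ [a]).length = w.length + 1 := by simp
    have hlt : ∀ i, i ≤ w.length → (if i ≤ w.length then s i else q') = s i := fun i hi => if_pos hi
    refine ⟨fun i => if i ≤ w.length then s i else q', by simpa using h0, by simp, ?_, ?_⟩
    · intro i hi
      rcases Nat.lt_succ_iff_lt_or_eq.1 (hlen ▸ hi : i < w.length + 1) with hi | rfl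
      · simpa [hi.le, Nat.succ_le_of_lt hi, List.getElem_append_left hi] using hs i hi
      · simpa [hl] using ht
    · intro g hg'
      rw [hlen, revSum, hg g, hg' w.length (by simp)]
      · simp [hl]
      · intro i hi
        rw [hg' i (by simp; omega)]
        simp [hi.le, Nat.succ_le_of_lt hi, List.getElem_append_left hi]

theorem reachable_iff (ω : A.State → L → A.State → Ordinal.{v}) {q : A.State} :
    A.Reachable q ↔ ∃ w α, Reaches A ω w q α := by
  constructor
  · rintro ⟨w, ρ, rfl⟩
    obtain ⟨α, -, h⟩ := ρ.reaches ω
    exact ⟨w, α, h⟩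
  · rintro ⟨w, α, h⟩
    obtain ⟨ρ, h, -⟩ := h.exists_run
    exact ⟨w, ρ, h⟩

theorem Reaches.le_lang (hω : ∀ q a q', A.weight q a q' = ω q a q') {w : List L} {q : A.State}
    {α : Ordinal.{v}} (h : Reaches A ω w q α) (hq : q ∈ A.final) : (α : WithBot Ordinal.{v}) ≤ A.lang w := by
  obtain ⟨ρ, rfl, hα⟩ := h.exists_run
  have hv : A.value ρ = α := by
    rw [value, if_pos hq, ← hα, Run.total]
    simp only [hω]
  rw [← hv]
  exact Finset.le_sup (f := id) ((A.values_finite w).mem_toFinset.2 ⟨ρ, rfl⟩)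

theorem exists_reaches_of_lang_ne_bot (hω : ∀ q a q', A.weight q a q' = ω q a q') {w : List L}
    (h : A.lang w ≠ ⊥) : ∃ q ∈ A.final, ∃ α, Reaches A ω w q α ∧ A.lang w = α := by
  have hne : (A.values_finite w).toFinset.Nonempty := by
    by_contra hne
    rw [Finset.not_nonempty_iff_eq_empty] at hne
    exact h (by rw [lang, hne, Finset.sup_empty])
  obtain ⟨x, hx, hlang⟩ := Finset.exists_mem_eq_sup _ hne id
  obtain ⟨ρ, rfl⟩ := (A.values_finite w).mem_toFinset.1 hx
  change A.lang w = A.value ρ at hlang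
  have hq : ρ.1 (Fin.last _) ∈ A.final := by
    by_contra hq
    exact h (by rw [hlang, value, if_neg hq])
  obtain ⟨α, hα, hr⟩ := ρ.reaches ω
  refine ⟨_, hq, α, hr, ?_⟩
  rw [hlang, ← hα, value, if_pos hq, Run.total]
  simp only [hω]

end WeightedAutomaton

/-! ### Trace pairs and words of a pre-proof -/

/-- The first `n + 1` entries of `f`, followed by `x`. -/
def extend {α : Type*} (f : ℕ → α) (n : ℕ) (x : α) (i : ℕ) : α := if i ≤ n then f i else x

theorem extend_of_le {α : Type*} (f : ℕ → α) {n i : ℕ} (x : α) (h : i ≤ n) :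
    extend f n x i = f i := if_pos h

theorem extend_succ {α : Type*} (f : ℕ → α) (n : ℕ) (x : α) : extend f n x (n + 1) = x :=
  if_neg (by omega)

theorem Trace.Follows.extend {N T : Type*} {d : N → N → T → T → Option Ordinal.{v}} {p : ℕ → N}
    {t : ℕ → T} {n : ℕ} (h : Follows d p t n) {ν : N} {τ : T} (hd : (d (p n) ν (t n) τ).isSome) :
    Follows d (extend p n ν) (extend t n τ) (n + 1) := by
  intro i hi
  rcases Nat.lt_succ_iff_lt_or_eq.1 hi with hi | rfl
  · rw [extend_of_le _ _ hi.le, extend_of_le _ _ hi, extend_of_le _ _ hi.le, extend_of_le _ _ hi]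
    exact h i hi
  · rwa [extend_of_le _ _ le_rfl, extend_of_le _ _ le_rfl, extend_succ, extend_succ]

theorem Trace.size_extend {N T : Type*} (d : N → N → T → T → Option Ordinal.{v}) (p : ℕ → N)
    (t : ℕ → T) (n : ℕ) (ν : N) (τ : T) :
    size d (_root_.extend p n ν) (_root_.extend t n τ) (n + 1) =
      (d (p n) ν (t n) τ).getD 0 + size d p t n := by
  rw [size, revSum, extend_of_le _ _ le_rfl, extend_of_le _ _ le_rfl, extend_succ, extend_succ]
  congr 1
  exact size_congr (fun x hx => extend_of_le _ _ hx) fun x hx => extend_of_le _ _ hx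

namespace PreProof

variable {E : CyclicSystem.{u, v}} {O : OrdinalTraceFunction E} (P : PreProof E)

theorem get_premise {ν ν' : P.Node} (h : P.Edge ν ν') :
    (P.inst ν).2.get (P.premise ν ν' h) = P.seq ν' := by
  classical
  simp [inst, premise]

variable {P}

theorem stepA_mem {ν ν' : P.Node} {τ τ' : E.TA} (h : (P.stepA ν ν' τ τ').isSome) :
    P.Edge ν ν' ∧ τ ∈ P.valsA ν ∧ τ' ∈ P.valsA ν' := by
  unfold stepA at h
  split at h
  · next he =>
    have := E.δA_dom _ _ (P.inst_mem ν) _ _ _ h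
    have h' := this.2
    erw [P.get_premise he] at h'
    exact ⟨he, this.1, h'⟩
  · simp at h

theorem stepC_mem {ν ν' : P.Node} {τ τ' : E.TC} (h : (P.stepC ν ν' τ τ').isSome) :
    P.Edge ν ν' ∧ τ ∈ P.valsC ν ∧ τ' ∈ P.valsC ν' := by
  unfold stepC at h
  split at h
  · next he =>
    have := E.δC_dom _ _ (P.inst_mem ν) _ _ _ h
    have h' := this.2
    erw [P.get_premise he] at h'
    exact ⟨he, this.1, h'⟩
  · simp at h

theorem stepA_injective (hE : E.TraceInjective) {ν ν' : P.Node} {τ τ' τ'' : E.TA}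
    (h : (P.stepA ν ν' τ τ'').isSome) (h' : (P.stepA ν ν' τ' τ'').isSome) : τ = τ' := by
  have he := (stepA_mem h).1
  rw [stepA, dif_pos he] at h h'
  exact (hE _ _ (P.inst_mem ν) _).1 _ _ _ h h'

theorem valsA_of_follows {p : ℕ → P.Node} {t : ℕ → E.TA} {n : ℕ}
    (h : Trace.Follows P.stepA p t n) (h0 : t 0 ∈ P.valsA (p 0)) {x : ℕ} (hx : x ≤ n) :
    t x ∈ P.valsA (p x) := by
  cases x with
  | zero => exact h0
  | succ x => exact (stepA_mem (h x hx)).2.2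

theorem valsC_of_follows {p : ℕ → P.Node} {t : ℕ → E.TC} {n : ℕ}
    (h : Trace.Follows P.stepC p t n) (h0 : t 0 ∈ P.valsC (p 0)) {x : ℕ} (hx : x ≤ n) :
    t x ∈ P.valsC (p x) := by
  cases x with
  | zero => exact h0
  | succ x => exact (stepC_mem (h x hx)).2.2

/-- The word consisting of the nodes `p 0, …, p n`. -/
def pathWord (p : ℕ → P.Node) (n : ℕ) : List P.Letter :=
  (List.range (n + 1)).map fun x => .inl (p x)

theorem pathWord_zero (p : ℕ → P.Node) : pathWord p 0 = [.inl (p 0)] := rfl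

theorem pathWord_succ (p : ℕ → P.Node) (n : ℕ) :
    pathWord p (n + 1) = pathWord p n ++ [.inl (p (n + 1))] := by
  rw [pathWord, List.range_succ, List.map_append]
  rfl

theorem pathWord_inj {p p' : ℕ → P.Node} {n n' : ℕ} (h : pathWord p n = pathWord p' n') :
    n = n' ∧ ∀ x ≤ n, p x = p' x := by
  have hn : n = n' := by simpa [pathWord] using congrArg List.length h
  subst hn
  refine ⟨rfl, fun x hx => ?_⟩
  simpa [pathWord, Nat.lt_succ_of_le hx] using congrArg (fun l => l[x]?) h

theorem pathWord_extend (p : ℕ → P.Node) (n : ℕ) (ν : P.Node) :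
    pathWord (extend p n ν) (n + 1) = pathWord p n ++ [.inl ν] := by
  rw [pathWord_succ, extend_succ]
  congr 1
  refine List.map_congr_left fun x hx => ?_
  rw [extend_of_le _ _ (Nat.le_of_lt_succ (List.mem_range.1 hx))]

theorem pathWord_ne_append_inr (p : ℕ → P.Node) (n : ℕ) (w : List P.Letter)
    (a : Set P.AllA × P.AllC) : pathWord p n ≠ w ++ [.inr a] := by
  intro h
  have : (.inr a : P.Letter) ∈ pathWord p n := by rw [h]; simp
  simp [pathWord] at this

/-! ### The runs of the right-hand automaton -/

variable (P) in
/-- The weights of the right-hand automaton as ordinals. -/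
noncomputable def ordWeightB : P.StateB → P.Letter → P.StateB → Ordinal.{v}
  | .pair ν τ, _, .pair ν' τ' => (P.stepC ν ν' τ.1 τ'.1).getD 0
  | _, _, _ => 0

variable {X : ExclusionPredicate O} {ν₀ : P.Node} {τ₀ : E.TC} {ρ₀ : E.TA} {n : ℕ}

theorem autB_weight (q : (P.autB X ν₀ τ₀).State) (a : P.Letter) (q' : (P.autB X ν₀ τ₀).State) :
    (P.autB X ν₀ τ₀).weight q a q' = P.ordWeightB q a q' := by
  change P.weightB q a q' = _
  cases q <;> cases q' <;> rfl

/-- `RunB X ν₀ τ₀ w q α` holds if `α` is the sum of the weights of a run of the right-hand automaton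
over `w` that ends in `q`. -/
abbrev RunB (X : ExclusionPredicate O) (ν₀ : P.Node) (τ₀ : E.TC) (w : List P.Letter) (q : P.StateB)
    (α : Ordinal.{v}) : Prop :=
  WeightedAutomaton.Reaches (P.autB X ν₀ τ₀) P.ordWeightB w q α

theorem runB_pair {p : ℕ → P.Node} {t : ℕ → E.TC} {m : ℕ} (hp : p 0 = ν₀) (ht : t 0 = τ₀)
    (h0 : τ₀ ∈ P.valsC ν₀) (h : Trace.Follows P.stepC p t m) (hm : ∃ ν, t m ∈ P.valsC ν) :
    RunB X ν₀ τ₀ (pathWord p m) (.pair (p m) ⟨t m, hm⟩) (Trace.size P.stepC p t m) := by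
  induction m with
  | zero =>
    have := WeightedAutomaton.Reaches.nil (A := P.autB X ν₀ τ₀) (ω := P.ordWeightB) |>.snoc
      (TransB.init (X := X) ⟨t 0, hm⟩ ht)
    rw [pathWord_zero, hp]
    convert this using 1
    exacts [rfl, (add_zero (0 : Ordinal.{v})).symm]
  | succ m ih =>
    have hs := h m m.lt_succ_self
    have := (ih (h.mono m.le_succ) ⟨_, (stepC_mem hs).2.1⟩).snoc
      (TransB.step (X := X) _ _ _ ⟨_, hm⟩ (stepC_mem hs).1 hs)
    rw [pathWord_succ]
    exact this

theorem runB_bot {p : ℕ → P.Node} {t : ℕ → E.TC} {m : ℕ} (hp : p 0 = ν₀) (ht : t 0 = τ₀)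
    (h0 : τ₀ ∈ P.valsC ν₀) (h : Trace.Follows P.stepC p t m) (ha : P.Axiomatic (p m))
    (hg : ¬ O.Ground (P.seq (p m)) (t m)) (he : ¬ X.excludes (P.inst (p m)) (t m))
    (hm : ∃ ν, t m ∈ P.valsC ν) :
    RunB X ν₀ τ₀ (pathWord p m ++ [.inr (P.equated O (p m) (t m), ⟨t m, hm⟩)]) .bot
      (Trace.size P.stepC p t m) := by
  have := (runB_pair (X := X) hp ht h0 h hm).snoc (TransB.equate (X := X) (p m) ⟨t m, hm⟩
    (valsC_of_follows h (by rwa [hp, ht]) le_rfl) ha hg he)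
  convert this using 1
  exact (zero_add _).symm

/-- The right-hand trace of size `α` that a run of the right-hand automaton over `w` ending in a given
state describes. -/
def TraceOfB (X : ExclusionPredicate O) (ν₀ : P.Node) (τ₀ : E.TC) (w : List P.Letter)
    (q : P.StateB) (α : Ordinal.{v}) : Prop :=
    match q with
    | .init => w = [] ∧ α = 0
    | .pair ν σ => ∃ m p t, p 0 = ν₀ ∧ t 0 = τ₀ ∧ Trace.Follows P.stepC p t m ∧ p m = ν ∧ t m = σ.1 ∧
        w = pathWord p m ∧ α = Trace.size P.stepC p t m
    | .bot => ∃ m p t, ∃ σ : P.AllC, p 0 = ν₀ ∧ t 0 = τ₀ ∧ Trace.Follows P.stepC p t m ∧ t m = σ.1 ∧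
        P.Axiomatic (p m) ∧ ¬ O.Ground (P.seq (p m)) σ.1 ∧ ¬ X.excludes (P.inst (p m)) σ.1 ∧
        σ.1 ∈ P.valsC (p m) ∧ w = pathWord p m ++ [.inr (P.equated O (p m) σ.1, σ)] ∧
        α = Trace.size P.stepC p t m

theorem traceOfB {w : List P.Letter} {q : (P.autB X ν₀ τ₀).State} {α : Ordinal.{v}}
    (h : WeightedAutomaton.Reaches (P.autB X ν₀ τ₀) P.ordWeightB w q α) :
    TraceOfB X ν₀ τ₀ w q α := by
  induction h with
  | nil => exact ⟨rfl, rfl⟩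
  | snoc _ ht ih =>
    cases ht with
    | init τ h =>
      obtain ⟨rfl, rfl⟩ := ih
      exact ⟨0, fun _ => ν₀, fun _ => τ₀, rfl, rfl, fun i hi => absurd hi (Nat.not_lt_zero i), rfl,
        h.symm, rfl, add_zero _⟩
    | step ν ν' τ τ' he hd =>
      obtain ⟨m, p, t, hp, ht, hf, rfl, hτ, rfl, rfl⟩ := ih
      rw [← hτ] at hd
      refine ⟨m + 1, extend p m ν', extend t m τ'.1, (extend_of_le _ _ m.zero_le).trans hp,
        (extend_of_le _ _ m.zero_le).trans ht, hf.extend hd, extend_succ .., extend_succ ..,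
        (pathWord_extend ..).symm, ?_⟩
      rw [Trace.size_extend, hτ]
      rfl
    | equate ν τ hτ ha hg he =>
      obtain ⟨m, p, t, hp, ht, hf, rfl, ht', rfl, rfl⟩ := ih
      exact ⟨m, p, t, τ, hp, ht, hf, ht', ha, hg, he, hτ, rfl, zero_add _⟩

/-! ### The runs of the approximate left-hand automata -/

variable (P) in
/-- The weights of the approximate left-hand automata as ordinals. -/
noncomputable def ordWeightA (n : ℕ) : P.StateA n → P.Letter → P.StateA n → Ordinal.{v}
  | .pair ν τ, _, .pair ν' τ' => (P.stepA ν ν' τ.1 τ'.1).getD 0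
  | _, _, _ => 0

theorem autA_weight (q : (P.autA O n ν₀ ρ₀).State) (a : P.Letter) (q' : (P.autA O n ν₀ ρ₀).State) :
    (P.autA O n ν₀ ρ₀).weight q a q' = P.ordWeightA n q a q' := by
  change P.weightA n q a q' = _
  cases q <;> cases q' <;> rfl

/-- `RunA O n ν₀ ρ₀ w q α` holds if `α` is the sum of the weights of a run of the `n`-th approximate
left-hand automaton over `w` that ends in `q`. -/
abbrev RunA (O : OrdinalTraceFunction E) (n : ℕ) (ν₀ : P.Node) (ρ₀ : E.TA) (w : List P.Letter)
    (q : P.StateA n) (α : Ordinal.{v}) : Prop :=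
  WeightedAutomaton.Reaches (P.autA O n ν₀ ρ₀) (P.ordWeightA n) w q α

theorem runA_pair {p : ℕ → P.Node} {t : ℕ → E.TA} {m : ℕ} (hp : p 0 = ν₀) (ht : t 0 = ρ₀)
    (h : Trace.Follows P.stepA p t m) (hm : ∃ ν, t m ∈ P.valsA ν) :
    RunA O n ν₀ ρ₀ (pathWord p m) (.pair (p m) ⟨t m, hm⟩) (Trace.size P.stepA p t m) := by
  induction m with
  | zero =>
    have := WeightedAutomaton.Reaches.nil (A := P.autA O n ν₀ ρ₀) (ω := P.ordWeightA n) |>.snoc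
      (TransA.init ⟨t 0, hm⟩ ht)
    rw [pathWord_zero, hp]
    convert this using 1
    exacts [rfl, (add_zero (0 : Ordinal.{v})).symm]
  | succ m ih =>
    have hs := h m m.lt_succ_self
    have := (ih (h.mono m.le_succ) ⟨_, (stepA_mem hs).2.1⟩).snoc
      (TransA.step _ _ _ ⟨_, hm⟩ (stepA_mem hs).1 hs)
    rw [pathWord_succ]
    exact this

theorem runA_bot {p : ℕ → P.Node} {t : ℕ → E.TA} {m : ℕ} (hp : p 0 = ν₀) (ht : t 0 = ρ₀)
    (h0 : ρ₀ ∈ P.valsA ν₀) (h : Trace.Follows P.stepA p t m) (ha : P.Axiomatic (p m)) (σ : P.AllC)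
    (hσ : σ.1 ∈ P.valsC (p m)) (he : O.Equates (P.seq (p m)) (t m) σ.1) :
    RunA O n ν₀ ρ₀ (pathWord p m ++ [.inr (P.equated O (p m) σ.1, σ)]) .bot
      (Trace.size P.stepA p t m) := by
  have hm := valsA_of_follows h (by rwa [hp, ht]) le_rfl
  have := (runA_pair (O := O) (n := n) hp ht h ⟨_, hm⟩).snoc (TransA.equate (p m) ⟨t m, _, hm⟩ σ
    ha hσ ⟨hm, he⟩)
  convert this using 1
  exact (zero_add _).symm

/-- A trace that follows the path up to `p k` may be given up at `p (k + 1)`, provided that this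
node occurs at most `n` times in the rest of the path. -/
theorem runA_top {p : ℕ → P.Node} {t : ℕ → E.TA} {k m : ℕ} (hp : p 0 = ν₀) (ht : t 0 = ρ₀)
    (h0 : ρ₀ ∈ P.valsA ν₀) (h : Trace.Follows P.stepA p t k) (hkm : k < m)
    (he : P.Edge (p k) (p (k + 1))) {V : Finset ℕ}
    (hV : ∀ x, x ∈ V ↔ (k < x ∧ x ≤ m) ∧ p x = p (k + 1)) (hn : V.card ≤ n) :
    ∃ i, RunA O n ν₀ ρ₀ (pathWord p m) (.top (p (k + 1)) i) (Trace.size P.stepA p t k) := by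
  suffices H : ∃ i : Fin n, i.1 + 1 = V.card ∧
      RunA O n ν₀ ρ₀ (pathWord p m) (.top (p (k + 1)) i) (Trace.size P.stepA p t k) from
    H.imp fun _ => And.right
  induction m, Nat.succ_le_of_lt hkm using Nat.le_induction generalizing V with
  | base =>
    have hV1 : V = {k + 1} := by
      ext x
      rw [hV, Finset.mem_singleton]
      exact ⟨fun hx => by omega, fun hx => by subst hx; exact ⟨by omega, rfl⟩⟩
    have hcard : V.card = 1 := by rw [hV1, Finset.card_singleton]
    have hk := valsA_of_follows h (by rwa [hp, ht]) le_rfl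
    have := (runA_pair (O := O) (n := n) hp ht h ⟨_, hk⟩).snoc
      (TransA.enter (p k) _ ⟨t k, _, hk⟩ he (by omega))
    refine ⟨⟨0, by omega⟩, hcard.symm, ?_⟩
    rw [Nat.succ_eq_add_one, pathWord_succ]
    convert this using 1
    exact (zero_add _).symm
  | succ m hm ih =>
    by_cases hlast : p (m + 1) = p (k + 1)
    · have hmem : m + 1 ∈ V := (hV _).2 ⟨by omega, hlast⟩
      obtain ⟨i, hi, hr⟩ := ih (V := V.erase (m + 1)) (by omega) (fun x => by
        rw [Finset.mem_erase, hV]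
        constructor
        · rintro ⟨h₁, h₂, h₃⟩; exact ⟨by omega, h₃⟩
        · rintro ⟨h₁, h₂⟩; exact ⟨by omega, by omega, h₂⟩)
        ((Finset.card_le_card (Finset.erase_subset _ _)).trans hn)
      rw [Finset.card_erase_of_mem hmem] at hi
      have hpos := Finset.card_pos.2 ⟨_, hmem⟩
      have := hr.snoc (TransA.count (p (k + 1)) i.1 (by omega))
      refine ⟨⟨i.1 + 1, by omega⟩, by simp only; omega, ?_⟩
      rw [pathWord_succ, hlast]
      convert this using 1
      exact (zero_add _).symm
    · obtain ⟨i, hi, hr⟩ := ih (V := V) (by omega) (fun x => by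
        rw [hV]
        constructor
        · rintro ⟨h₁, h₂⟩
          refine ⟨⟨h₁.1, ?_⟩, h₂⟩
          rcases Nat.lt_succ_iff_lt_or_eq.1 (Nat.lt_succ_of_le h₁.2) with h | rfl
          · omega
          · exact absurd h₂ hlast
        · rintro ⟨h₁, h₂⟩; exact ⟨by omega, h₂⟩) hn
      have := hr.snoc (TransA.stay (p (k + 1)) _ i hlast)
      refine ⟨i, hi, ?_⟩
      rw [pathWord_succ]
      convert this using 1
      exact (zero_add _).symm

/-- The left-hand trace of size `α` that a run of an approximate left-hand automaton over `w` ending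
in a given state describes. -/
def TraceOfA (O : OrdinalTraceFunction E) (ν₀ : P.Node) (ρ₀ : E.TA) (w : List P.Letter)
    (q : P.StateA n) (α : Ordinal.{v}) : Prop :=
    match q with
    | .init => w = [] ∧ α = 0
    | .pair ν ρ => ∃ m p t, p 0 = ν₀ ∧ t 0 = ρ₀ ∧ Trace.Follows P.stepA p t m ∧ p m = ν ∧ t m = ρ.1 ∧
        w = pathWord p m ∧ α = Trace.size P.stepA p t m
    | .top _ _ => ∃ m p t, ∃ k ≤ m, t 0 = ρ₀ ∧ Trace.Follows P.stepA p t k ∧ w = pathWord p m ∧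
        α = Trace.size P.stepA p t k
    | .bot => ∃ m p t, ∃ σ : P.AllC, t 0 = ρ₀ ∧ Trace.Follows P.stepA p t m ∧
        O.Equates (P.seq (p m)) (t m) σ.1 ∧
        w = pathWord p m ++ [.inr (P.equated O (p m) σ.1, σ)] ∧ α = Trace.size P.stepA p t m

theorem traceOfA {w : List P.Letter} {q : (P.autA O n ν₀ ρ₀).State} {α : Ordinal.{v}}
    (h : WeightedAutomaton.Reaches (P.autA O n ν₀ ρ₀) (P.ordWeightA n) w q α) :
    TraceOfA O ν₀ ρ₀ w q α := by
  induction h with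
  | nil => exact ⟨rfl, rfl⟩
  | snoc _ ht ih =>
    cases ht with
    | init τ h =>
      obtain ⟨rfl, rfl⟩ := ih
      exact ⟨0, fun _ => ν₀, fun _ => ρ₀, rfl, rfl, fun i hi => absurd hi (Nat.not_lt_zero i), rfl,
        h.symm, rfl, add_zero _⟩
    | step ν ν' τ τ' he hd =>
      obtain ⟨m, p, t, hp, ht, hf, rfl, hτ, rfl, rfl⟩ := ih
      rw [← hτ] at hd
      refine ⟨m + 1, extend p m ν', extend t m τ'.1, (extend_of_le _ _ m.zero_le).trans hp,
        (extend_of_le _ _ m.zero_le).trans ht, hf.extend hd, extend_succ .., extend_succ ..,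
        (pathWord_extend ..).symm, ?_⟩
      rw [Trace.size_extend, hτ]
      rfl
    | equate ν τ τ' ha hτ' hτ =>
      obtain ⟨m, p, t, hp, ht, hf, rfl, ht', rfl, rfl⟩ := ih
      refine ⟨m, p, t, τ', ht, hf, ?_, rfl, zero_add _⟩
      rw [ht']
      exact hτ.2
    | enter ν ν' τ he hn =>
      obtain ⟨m, p, t, hp, ht, hf, rfl, ht', rfl, rfl⟩ := ih
      have hpre : ∀ x ≤ m, p x = extend p m ν' x := fun x hx => (extend_of_le _ _ hx).symm
      exact ⟨m + 1, extend p m ν', t, m, m.le_succ, ht, hf.congr hpre fun _ _ => rfl,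
        (pathWord_extend ..).symm, (zero_add _).trans (Trace.size_congr hpre fun _ _ => rfl)⟩
    | stay ν ν' i hν =>
      obtain ⟨m, p, t, k, hk, ht, hf, rfl, rfl⟩ := ih
      have hpre : ∀ x ≤ k, p x = extend p m ν' x :=
        fun x hx => (extend_of_le _ _ (hx.trans hk)).symm
      exact ⟨m + 1, extend p m ν', t, k, hk.trans m.le_succ, ht, hf.congr hpre fun _ _ => rfl,
        (pathWord_extend ..).symm, (zero_add _).trans (Trace.size_congr hpre fun _ _ => rfl)⟩
    | count ν i hi =>
      obtain ⟨m, p, t, k, hk, ht, hf, rfl, rfl⟩ := ih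
      have hpre : ∀ x ≤ k, p x = extend p m ν x :=
        fun x hx => (extend_of_le _ _ (hx.trans hk)).symm
      exact ⟨m + 1, extend p m ν, t, k, hk.trans m.le_succ, ht, hf.congr hpre fun _ _ => rfl,
        (pathWord_extend ..).symm, (zero_add _).trans (Trace.size_congr hpre fun _ _ => rfl)⟩

end PreProof

/-! ### Ambiguity of the approximate left-hand automata -/

namespace PreProof

variable {E : CyclicSystem.{u, v}} {O : OrdinalTraceFunction E} {P : PreProof E}
  {ν₀ : P.Node} {ρ₀ : E.TA} {n : ℕ}

/-- The states from which a run may still be following a trace: the initial state and the pairs. -/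
def StateA.IsLive : P.StateA n → Prop
  | .init => True
  | .pair _ _ => True
  | .bot => False
  | .top _ _ => False

theorem TransA.isLive {q q' : P.StateA n} {a : P.Letter} (h : P.TransA O n ν₀ ρ₀ q a q')
    (hq' : q'.IsLive) : q.IsLive := by
  cases h <;> trivial

/-- Away from live states, a transition is determined by its target and its letter, unless it leaves
the live states. -/
theorem TransA.eq_or_isLive {q r q' : P.StateA n} {a : P.Letter} (h : P.TransA O n ν₀ ρ₀ q a q')
    (h' : P.TransA O n ν₀ ρ₀ r a q') (hq' : ¬ q'.IsLive) : q = r ∨ q.IsLive ∧ r.IsLive := by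
  cases h with
  | init => exact absurd trivial hq'
  | step => exact absurd trivial hq'
  | equate => exact .inr ⟨trivial, h'.casesOn (motive := fun q _ q' _ => q' = .bot → q.IsLive)
      (by simp) (by simp) (fun _ _ _ _ _ _ _ => trivial) (by simp) (by simp) (by simp) rfl⟩
  | enter =>
    cases h' with
    | enter => exact .inr ⟨trivial, trivial⟩
    | stay _ _ _ h => exact absurd rfl h
  | stay _ _ _ h =>
    cases h' with
    | enter => exact absurd rfl h
    | stay => exact .inl rfl
    | count => exact absurd rfl h
  | count =>
    cases h' with
    | stay _ _ _ h => exact absurd rfl h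
    | count => exact .inl rfl

theorem TransA.ne_init {q q' : P.StateA n} {a : P.Letter} (h : P.TransA O n ν₀ ρ₀ q a q') :
    q' ≠ .init := by
  cases h <;> simp

theorem TransA.eq_inl {q : P.StateA n} {a : P.Letter} {ν : P.Node} {τ : P.AllA}
    (h : P.TransA O n ν₀ ρ₀ q a (.pair ν τ)) : a = .inl ν := by
  cases h <;> rfl

theorem TransA.isSome {ν : P.Node} {τ : P.AllA} {a : P.Letter} {q' : P.StateA n}
    (h : P.TransA O n ν₀ ρ₀ (.pair ν τ) a q') (hq' : q'.IsLive) :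
    ∃ ν' τ', q' = .pair ν' τ' ∧ (P.stepA ν ν' τ.1 τ'.1).isSome := by
  cases h with
  | step _ ν' _ τ' _ hd => exact ⟨ν', τ', rfl, hd⟩
  | equate => exact hq'.elim
  | enter => exact hq'.elim

open WeightedAutomaton

/-- If the trace pair function is trace injective, two runs that are in the same live state at the
same time have agreed so far. -/
theorem states_eq_of_isLive (hE : E.TraceInjective) {w : List P.Letter}
    (ρ ρ' : (P.autA O n ν₀ ρ₀).Run w) {x : ℕ} (hx : x ≤ w.length)
    (hl : StateA.IsLive (ρ.states x)) (h : ρ.states x = ρ'.states x) :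
    ∀ y ≤ x, ρ.states y = ρ'.states y := by
  induction x with
  | zero => intro y hy; rwa [Nat.le_zero.1 hy]
  | succ x ih =>
    have ht : P.TransA O n ν₀ ρ₀ _ _ _ := ρ.states_trans hx
    have ht' : P.TransA O n ν₀ ρ₀ _ _ _ := ρ'.states_trans hx
    have hlx := ht.isLive hl
    have hlx' := ht'.isLive (h ▸ hl)
    have heq : ρ.states x = ρ'.states x := by
      cases x with
      | zero => rw [ρ.states_zero, ρ'.states_zero]
      | succ x =>
        -- Both live states carry the node just read, and injectivity determines the value.
        have hp : P.TransA O n ν₀ ρ₀ _ _ _ := ρ.states_trans (Nat.lt_of_succ_lt hx)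
        have hp' : P.TransA O n ν₀ ρ₀ _ _ _ := ρ'.states_trans (Nat.lt_of_succ_lt hx)
        revert ht ht' hp hp' hlx hlx' hl
        rw [← h]
        generalize (ρ.states (x + 1) : P.StateA n) = q
        generalize (ρ'.states (x + 1) : P.StateA n) = q'
        intro hl ht ht' hlx hlx' hp hp'
        match q, q' with
        | .init, _ => exact absurd rfl hp.ne_init
        | _, .init => exact absurd rfl hp'.ne_init
        | .pair ν τ, .pair ν' τ' =>
          obtain rfl : ν = ν' := Sum.inl.inj (hp.eq_inl.symm.trans hp'.eq_inl)
          obtain ⟨_, _, hq, hs⟩ := ht.isSome hl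
          obtain ⟨_, _, hq', hs'⟩ := ht'.isSome hl
          rw [hq] at hq'
          cases hq'
          rw [Subtype.ext (stepA_injective hE hs hs')]
    intro y hy
    rcases Nat.lt_succ_iff_lt_or_eq.1 (Nat.lt_succ_of_le hy) with hy | rfl
    · exact ih (by omega) hlx heq y (by omega)
    · exact h

theorem exists_last_live {w : List P.Letter} (ρ : (P.autA O n ν₀ ρ₀).Run w) :
    ∃ j ≤ w.length, StateA.IsLive (ρ.states j) ∧
      ∀ y, j < y → y ≤ w.length → ¬ StateA.IsLive (ρ.states y) := by
  classical
  refine ⟨Nat.findGreatest (fun j => StateA.IsLive (ρ.states j)) w.length,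
    Nat.findGreatest_le _, ?_, fun y h h' => Nat.findGreatest_is_greatest h h'⟩
  refine Nat.findGreatest_spec (P := fun j => StateA.IsLive (ρ.states j)) (Nat.zero_le _) ?_
  rw [ρ.states_zero]
  trivial

/-- Going backwards from the same final state, two runs agree until one of them, and then both, reach
a live state. -/
theorem states_eq_or_isLive {w : List P.Letter} (ρ ρ' : (P.autA O n ν₀ ρ₀).Run w) {j j' : ℕ}
    (hj : ∀ y, j < y → y ≤ w.length → ¬ StateA.IsLive (ρ.states y)) (hj'l : j' ≤ w.length)
    (hj' : StateA.IsLive (ρ'.states j')) (hlast : ρ.states w.length = ρ'.states w.length) (d : ℕ) :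
    ∀ x, x + d = w.length → j ≤ x → j' ≤ x ∧ (ρ.states x = ρ'.states x ∨
      StateA.IsLive (ρ.states x) ∧ StateA.IsLive (ρ'.states x)) := by
  induction d with
  | zero =>
    rintro x hx -
    obtain rfl : x = w.length := hx
    exact ⟨hj'l, .inl hlast⟩
  | succ d ih =>
    intro x hx hjx
    obtain ⟨h₁, h₂⟩ := ih (x + 1) (by omega) (by omega)
    have hdead := hj (x + 1) (by omega) (by omega)
    have heq := h₂.resolve_right fun h => hdead h.1
    refine ⟨?_, ?_⟩
    · rcases Nat.lt_succ_iff_lt_or_eq.1 (Nat.lt_succ_of_le h₁) with h | rfl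
      · omega
      · exact absurd (heq ▸ hj') hdead
    · have ht : P.TransA O n ν₀ ρ₀ _ _ _ := ρ.states_trans (i := x) (by omega)
      have ht' : P.TransA O n ν₀ ρ₀ _ _ _ := ρ'.states_trans (i := x) (by omega)
      rw [← heq] at ht'
      exact ht.eq_or_isLive ht' hdead

/-- Runs are determined by their last state and their last live state. -/
theorem finitelyAmbiguous_autA (hE : E.TraceInjective) : (P.autA O n ν₀ ρ₀).FinitelyAmbiguous := by
  refine ⟨Nat.card ((P.autA O n ν₀ ρ₀).State × (P.autA O n ν₀ ρ₀).State), fun w => ?_⟩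
  choose piv hpl hp hd using exists_last_live (O := O) (n := n) (ν₀ := ν₀) (ρ₀ := ρ₀) (w := w)
  refine Nat.card_le_card_of_injective (fun ρ => (ρ.states w.length, ρ.states (piv ρ))) ?_
  intro ρ ρ' h
  obtain ⟨hlast, hpiv⟩ := Prod.mk.inj h
  have key := states_eq_or_isLive ρ ρ' (hd ρ) (hpl ρ') (hp ρ') hlast
  have key' := states_eq_or_isLive ρ' ρ (hd ρ') (hpl ρ) (hp ρ) hlast.symm
  have hjj : piv ρ = piv ρ' := le_antisymm
    (key' (w.length - piv ρ') _ (Nat.add_sub_cancel' (hpl ρ')) le_rfl).1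
    (key (w.length - piv ρ) _ (Nat.add_sub_cancel' (hpl ρ)) le_rfl).1
  have hall : ∀ x ≤ w.length, ρ.states x = ρ'.states x := by
    intro x hx
    rcases le_or_gt x (piv ρ) with hxj | hxj
    · exact states_eq_of_isLive hE ρ ρ' (hpl ρ) (hp ρ) (hpiv.trans (by rw [hjj])) x hxj
    · exact (key (w.length - x) x (Nat.add_sub_cancel' hx) hxj.le).2.resolve_right
        fun h => hd ρ x hxj hx h.1
  refine Subtype.ext (funext fun i => ?_)
  rw [← ρ.states_eq, ← ρ'.states_eq]
  exact hall i (Nat.le_of_lt_succ i.2)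

end PreProof

/-! ### Left-hand traces that can be completed to runs -/

theorem Trace.Follows.size_eq {N T : Type*} {d : N → N → T → T → Option Ordinal.{v}} {ν₀ : N}
    {τ₀ : T} (hfin : FinitelyProgressing d ν₀ τ₀) {p : ℕ → N} {t : ℕ → T} {n : ℕ}
    (h : Follows d p t n) (hp : p 0 = ν₀) (ht : t 0 = τ₀) :
    size d p t n = (StateWalk.weight (natStep d) (fun x => (p x, t x)) n : ℕ) :=
  size_eq_weight hfin (h.isWalk hp ht)

namespace PreProof

open StateWalk Trace

variable {E : CyclicSystem.{u, v}} {O : OrdinalTraceFunction E} {P : PreProof E}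
  {X : ExclusionPredicate O} {ν₀ : P.Node} {ρ₀ : E.TA} {τ₀ : E.TC} {n : ℕ}

theorem card_valsA_le (ν : P.Node) : (P.valsA ν).card ≤ P.width :=
  (le_max_left _ _).trans (Finset.le_sup (f := fun ν => max (P.valsA ν).card (P.valsC ν).card)
    (Finset.mem_univ ν))

theorem card_valsC_le (ν : P.Node) : (P.valsC ν).card ≤ P.width :=
  (le_max_right _ _).trans (Finset.le_sup (f := fun ν => max (P.valsA ν).card (P.valsC ν).card)
    (Finset.mem_univ ν))

/-- There are finitely many left-hand trace pairs, so their largest value is a natural number. -/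
theorem exists_maxStep_eq (hfin : Trace.FinitelyProgressing P.stepA ν₀ ρ₀) :
    ∃ k : ℕ, P.maxStep ν₀ ρ₀ = k ∧
      ∀ x y, ReachableStep P.stepA ν₀ ρ₀ x y → natStep P.stepA x y ≤ k := by
  set A : Set Ordinal.{v} := {α | ∃ ν' ν'' τ' τ'', Trace.Reachable P.stepA ν₀ ρ₀ ν' τ' ∧
    P.stepA ν' ν'' τ' τ'' = some α} with hA
  have hfinite : A.Finite := by
    have : (⋃ ν' : P.Node, ⋃ ν'' : P.Node, ⋃ τ' ∈ P.valsA ν', ⋃ τ'' ∈ P.valsA ν'',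
        {(P.stepA ν' ν'' τ' τ'').getD 0}).Finite :=
      Set.finite_iUnion fun ν' => Set.finite_iUnion fun ν'' =>
        (P.valsA ν').finite_toSet.biUnion fun τ' _ =>
          (P.valsA ν'').finite_toSet.biUnion fun τ'' _ => Set.finite_singleton _
    refine this.subset ?_
    rintro α ⟨ν', ν'', τ', τ'', -, h⟩
    have hmem := stepA_mem (h ▸ rfl : (P.stepA ν' ν'' τ' τ'').isSome)
    simp only [Set.mem_iUnion, Set.mem_singleton_iff]
    exact ⟨ν', ν'', τ', hmem.2.1, τ'', hmem.2.2, by rw [h]; rfl⟩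
  have hlt : P.maxStep ν₀ ρ₀ < Ordinal.omega0 := by
    rcases A.eq_empty_or_nonempty with he | hne
    · rw [maxStep, ← hA, he, csSup_empty]
      exact Ordinal.omega0_pos
    · obtain ⟨ν', ν'', τ', τ'', hr, h⟩ := hne.csSup_mem hfinite
      exact hfin _ _ _ _ _ hr h
  obtain ⟨k, hk⟩ := Ordinal.lt_omega0.1 hlt
  refine ⟨k, hk, fun x y hxy => ?_⟩
  obtain ⟨α, hα⟩ := Option.isSome_iff_exists.1 hxy.2
  have hle : α ≤ P.maxStep ν₀ ρ₀ := le_csSup hfinite.bddAbove ⟨_, _, _, _, hxy.1, hα⟩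
  have := natStep_cast hfin hxy.1 (y := y)
  rw [hα, Option.getD_some] at this
  rw [← this, hk] at hle
  exact_mod_cast hle

variable (P) in
/-- The triples of a node and two of its left-hand trace values. -/
noncomputable def triples : Finset (P.Node × E.TA × E.TA) :=
  (Finset.univ.sigma fun ν => P.valsA ν ×ˢ P.valsA ν).map
    ⟨fun x => (x.1, x.2), fun ⟨_, _⟩ ⟨_, _⟩ h => by cases h; rfl⟩

theorem mem_triples {ν : P.Node} {τ τ' : E.TA} (h : τ ∈ P.valsA ν) (h' : τ' ∈ P.valsA ν) :
    (ν, τ, τ') ∈ P.triples :=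
  Finset.mem_map.2 ⟨⟨ν, τ, τ'⟩, by simp [h, h'], rfl⟩

theorem card_triples : P.triples.card = P.threshold := by
  rw [triples, Finset.card_map, Finset.card_sigma, threshold]

/-- If the node where a left-hand trace is given up recurs often, some other left-hand trace is at
least as large and can be followed until that node recurs only a few more times. Here `V` is the set of
the visits of that node from the position `k + 1` at which the trace `t'` is given up.

The node recurs with the same right-hand value; the right-hand trace is pumped there until no
left-hand trace that ends earlier can be as large. The left-hand trace that exists for the pumped
trace cannot be much smaller than the given one when the latter ends, since the proof is balanced,
and makes up for the difference on the remaining visits, since the proof is dynamic. -/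
theorem exists_trace_of_recurrence (hfin : P.FinitelyProgressing ν₀ ρ₀ τ₀)
    (hdyn : P.Dynamic ν₀ ρ₀ τ₀) (hbal : P.Balanced ν₀ ρ₀) (hτ₀ : τ₀ ∈ P.valsC ν₀) {M : ℕ}
    (hM : ∀ x y, ReachableStep P.stepA ν₀ ρ₀ x y → natStep P.stepA x y ≤ M)
    (hn : 2 + P.threshold * M * P.width + P.width ≤ n)
    {rel : Ordinal.{v} → Ordinal.{v} → Prop} (hrel : ∀ α β, rel α β → α ≤ β)
    (hord : P.TraceOrder X rel ν₀ τ₀ ρ₀) {p : ℕ → P.Node} {t : ℕ → E.TC} {m : ℕ}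
    (hp : p 0 = ν₀) (ht : t 0 = τ₀) (hmax : P.IsPositiveMaximal X p t m) {t' : ℕ → E.TA} {k : ℕ}
    (ht' : t' 0 = ρ₀) (hf' : Follows P.stepA p t' k) {V : Finset ℕ}
    (hV : ∀ x, x ∈ V ↔ (k < x ∧ x ≤ m) ∧ p x = p (k + 1)) (hVn : n < V.card) :
    ∃ i u, k < i ∧ i + 1 ≤ m ∧ u 0 = ρ₀ ∧ Follows P.stepA p u i ∧ p (i + 1) = p (k + 1) ∧
      size P.stepA p t' k ≤ size P.stepA p u i ∧
      (V.filter (i < ·)).card ≤ n := by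
  classical
  obtain ⟨hf, hterm, hexcl⟩ := hmax
  have hvals : ∀ x ∈ V, t x ∈ P.valsC (p (k + 1)) := fun x hx => by
    have := (hV x).1 hx
    rw [← this.2]
    exact valsC_of_follows hf (by rwa [hp, ht]) this.1.2
  -- `i` is the last visit whose right-hand value recurs.
  obtain ⟨i, ⟨hi, j, hj, hij, htij⟩, hlast⟩ : ∃ i, (i ∈ V ∧ ∃ j ∈ V, i < j ∧ t i = t j) ∧
      ∀ x ∈ V, i < x → ∀ y ∈ V, x < y → t x ≠ t y := by
    obtain ⟨x, hx, y, hy, hne, hxy⟩ := Finset.exists_ne_map_eq_of_card_lt_of_maps_to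
      (t := P.valsC (p (k + 1))) (f := t) (((card_valsC_le _).trans (by omega)).trans_lt hVn) hvals
    have hI : (V.filter fun i => ∃ j ∈ V, i < j ∧ t i = t j).Nonempty := by
      rcases lt_or_gt_of_ne hne with h | h
      · exact ⟨x, Finset.mem_filter.2 ⟨hx, y, hy, h, hxy⟩⟩
      · exact ⟨y, Finset.mem_filter.2 ⟨hy, x, hx, h, hxy.symm⟩⟩
    refine ⟨_, Finset.mem_filter.1 (Finset.max'_mem _ hI), fun x hx hlt y hy hxy h => ?_⟩
    exact absurd (Finset.le_max' _ x (Finset.mem_filter.2 ⟨hx, y, hy, hxy, h⟩)) (not_le.2 hlt)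
  -- The visits after `i` have distinct right-hand values, so most visits are before `i`.
  have hafter : (V.filter (i < ·)).card ≤ P.width := by
    refine le_trans (Finset.card_le_card_of_injOn t (fun x hx => ?_) fun x hx y hy h => ?_)
      (card_valsC_le (p (k + 1)))
    · exact hvals x (Finset.mem_filter.1 hx).1
    · obtain ⟨hx, hix⟩ := Finset.mem_filter.1 hx
      obtain ⟨hy, hiy⟩ := Finset.mem_filter.1 hy
      rcases lt_trichotomy x y with hlt | rfl | hlt
      · exact absurd h (hlast x hx hix y hy hlt)
      · rfl
      · exact absurd h.symm (hlast y hy hiy x hx hlt)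
  have hupto : (V.filter (i - 1 < ·)).card ≤ P.width + 1 := by
    refine (Finset.card_le_card (t := insert i (V.filter (i < ·))) fun x hx => ?_).trans
      ((Finset.card_insert_le _ _).trans (Nat.succ_le_succ hafter))
    obtain ⟨hx, hlt⟩ := Finset.mem_filter.1 hx
    rw [Finset.mem_insert, Finset.mem_filter]
    rcases Nat.lt_or_ge i x with h | h
    · exact .inr ⟨hx, h⟩
    · exact .inl (by omega)
  have hbefore : P.threshold * M * P.width < (V.filter fun x => ¬ i - 1 < x).card := by
    have := Finset.card_filter_add_card_filter_not (s := V) (i - 1 < ·)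
    omega
  have hiV := (hV i).1 hi
  have hjV := (hV j).1 hj
  have hk1 : k + 1 ∈ V := (hV _).2 ⟨by omega, rfl⟩
  have hki : k + 1 < i := by
    obtain ⟨x, hx⟩ := Finset.card_pos.1 (Nat.zero_lt_of_lt hbefore)
    have := (hV x).1 (Finset.mem_filter.1 hx).1
    have := (Finset.mem_filter.1 hx).2
    omega
  -- Pump the right-hand trace beyond the size of any left-hand trace with at most `i` steps.
  obtain ⟨m', s, hs, -, hpre, hend, hsize⟩ := exists_pumped
    (weight_pos_of_dynamic hfin.2 hdyn.2) (hf.isWalk hp ht) hij hjV.1.2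
    (Prod.ext (hiV.2.trans hjV.2.symm) htij) (i * M + 1)
  have hs0 := hpre 0 (Nat.zero_le _)
  obtain ⟨l, -, u, hu, hfu, hle, -⟩ := hord m' (fun x => (s x).1) (fun x => (s x).2)
    (by simpa only [hs0] using hp) (by simpa only [hs0] using ht)
    ⟨follows_of_isWalk hs, by simpa only [hend] using hterm, by simpa only [hend] using hexcl⟩
  have hil : i < l := by
    have hle := hrel _ _ hle
    have hs0' : (s 0).1 = ν₀ := by rw [hs0, hp]
    rw [size_eq_weight hfin.2 hs, hfu.size_eq hfin.1 hs0' hu, Nat.cast_le] at hle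
    have hup : weight (natStep P.stepA) (fun x => ((s x).1, u x)) l ≤ l * M := by
      simpa [weight] using Finset.sum_le_card_nsmul (Finset.range l) _ M
        fun x hx => hM _ _ (hfu.isWalk hs0' hu x (Finset.mem_range.1 hx))
    by_contra! hcon
    have := Nat.mul_le_mul_right M hcon
    omega
  have hfi : Follows P.stepA p u i := (hfu.mono hil.le).congr
    (fun x hx => by rw [hpre x (hx.trans hij.le)]) fun _ _ => rfl
  -- At `k`, the trace `u` lags behind `t'` by at most `threshold * M`, and it gains that much by `i - 1`.
  have hbalance := weight_le_weight_add_of_balanced hfin.1 hbal (F := P.triples) hM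
    (fun _ _ _ _ _ _ h₁ h₂ => ⟨mem_triples (stepA_mem h₁).2.1 (stepA_mem h₂).2.1,
      mem_triples (stepA_mem h₁).2.2 (stepA_mem h₂).2.2⟩) hp ht' hu hf'
    (hfi.mono (by omega))
  have hgain := weight_add_le_of_visits (weight_pos_of_dynamic hfin.1 hdyn.1)
    (hfi.isWalk hp hu) (a := k) (b := i - 1) (m := P.threshold * M) (Nat.sub_le _ _)
    (F := (P.valsA (p (k + 1))).map ⟨Prod.mk (p (k + 1)), Prod.mk_right_injective _⟩)
    (by rw [Finset.card_map]; exact card_valsA_le _) (fun x hx => by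
      obtain ⟨hx, hxi⟩ := Finset.mem_filter.1 hx
      obtain ⟨⟨hkx, -⟩, hpx⟩ := (hV x).1 hx
      obtain ⟨y, rfl⟩ : ∃ y, x = y + 1 := ⟨x - 1, by omega⟩
      refine ⟨hkx.le, by omega, Finset.mem_map.2 ⟨u (y + 1), ?_, by simp [hpx]⟩⟩
      rw [← hpx]
      exact (stepA_mem (hfi y (by omega))).2.2) hbefore
  refine ⟨i - 1, u, by omega, by omega, hu, hfi.mono (Nat.sub_le _ _), ?_, ?_, by omega⟩
  · rw [Nat.sub_add_cancel (by omega)]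
    exact hiV.2
  · rw [hf'.size_eq hfin.1 hp ht', (hfi.mono (Nat.sub_le i 1)).size_eq hfin.1 hp hu, Nat.cast_le]
    rw [card_triples] at hbalance
    omega

/-! ### Trace ordering and language inclusion -/

variable (P) in
theorem axiomatic_terminal {ν : P.Node} (h : P.Axiomatic ν) (τ : E.TC) : P.Terminal ν τ := by
  intro ν' he
  rw [Edge, h] at he
  simp at he

/-- Inclusion of languages, with the right-hand automaton grounded, implies the trace ordering: the
word that consists of the path of a positive maximal trace, followed by a letter for the equated
values if the trace does not end in a ground one, has a run in the right-hand automaton, and a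
maximal run of the left-hand automaton on it describes a left-hand trace. -/
theorem traceOrder_of_lang (hτ₀ : τ₀ ∈ P.valsC ν₀) {r : WithBot Ordinal.{v} → WithBot Ordinal.{v} → Prop}
    (hle : ∀ x y, r x y → x ≤ y) (htr : ∀ x y z, x ≤ y → r y z → r x z)
    (hlang : ∀ w, (P.autB X ν₀ τ₀).lang w ≠ ⊥ →
      r ((P.autB X ν₀ τ₀).lang w) ((P.autA O n ν₀ ρ₀).lang w))
    (hg : P.GroundedB X ν₀ τ₀) : P.TraceOrder X (fun α β => r α β) ν₀ τ₀ ρ₀ := by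
  rintro m p t hp ht ⟨hf, hterm, hexcl⟩
  have hm : t m ∈ P.valsC (p m) := valsC_of_follows hf (by rwa [hp, ht]) le_rfl
  have hrun : ∀ (w : List P.Letter) (q : P.StateB),
      RunB X ν₀ τ₀ w q (size P.stepC p t m) → P.FinalB X q →
      ∃ q' β, q' ≠ StateA.init ∧ RunA O n ν₀ ρ₀ w q' β ∧
        r (size P.stepC p t m) (β : WithBot Ordinal.{v}) := by
    intro w q hr hq
    have hB := hr.le_lang autB_weight hq
    have hne : (P.autB X ν₀ τ₀).lang w ≠ ⊥ := fun h => by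
      rw [h, le_bot_iff] at hB
      exact WithBot.coe_ne_bot hB
    have hAB := htr _ _ _ hB (hlang w hne)
    have hneA : (P.autA O n ν₀ ρ₀).lang w ≠ ⊥ := fun h => by
      rw [h] at hAB
      exact WithBot.coe_ne_bot (le_bot_iff.1 (hle _ _ hAB))
    obtain ⟨q', hq', β, hβ, hl⟩ :=
      WeightedAutomaton.exists_reaches_of_lang_ne_bot autA_weight hneA
    exact ⟨q', β, hq', hβ, hl ▸ hAB⟩
  by_cases hcase : P.Axiomatic (p m) ∧ ¬ O.Ground (P.seq (p m)) (t m)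
  · obtain ⟨ha, hng⟩ := hcase
    obtain ⟨q', β, hq', hA, hrel⟩ := hrun _ _ (runB_bot hp ht hτ₀ hf ha hng hexcl ⟨_, hm⟩) trivial
    have htrace := traceOfA hA
    match q' with
    | .init => exact absurd rfl hq'
    | .pair _ _ =>
      obtain ⟨m', p', t', -, -, -, -, -, hw, -⟩ := htrace
      exact absurd hw.symm (pathWord_ne_append_inr _ _ _ _)
    | .top _ _ =>
      obtain ⟨m', p', t', k, -, -, -, hw, -⟩ := htrace
      exact absurd hw.symm (pathWord_ne_append_inr _ _ _ _)
    | .bot =>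
      obtain ⟨m', p', t', σ, ht', hf', heq, hw, rfl⟩ := htrace
      obtain ⟨hw, hσ⟩ := List.append_inj' hw rfl
      obtain ⟨rfl, hpp⟩ := pathWord_inj hw
      have hσ : σ.1 = t m := by
        simp only [List.cons.injEq, Sum.inr.injEq, Prod.mk.injEq, and_true] at hσ
        rw [← hσ.2]
      have hpp' : ∀ x ≤ m, p' x = p x := fun x hx => (hpp x hx).symm
      refine ⟨m, le_rfl, t', ht', hf'.congr hpp' fun _ _ => rfl, ?_, .inr ⟨ha, rfl, ?_⟩⟩
      · rwa [size_congr hpp' fun _ _ => rfl] at hrel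
      · rwa [hpp' m le_rfl, hσ] at heq
  · have hfinal : P.FinalB X (.pair (p m) ⟨t m, _, hm⟩) := by
      by_cases ha : P.Axiomatic (p m)
      · exact .inr ⟨ha, not_not.1 fun h => hcase ⟨ha, h⟩, hexcl⟩
      · exact .inl ⟨ha, hterm, hexcl⟩
    have hB := runB_pair (X := X) hp ht hτ₀ hf ⟨_, hm⟩
    have hground : O.Ground (P.seq (p m)) (t m) :=
      hg _ _ hfinal ((WeightedAutomaton.reachable_iff P.ordWeightB).2 ⟨_, _, hB⟩)
    obtain ⟨q', β, hq', hA, hrel⟩ := hrun _ _ hB hfinal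
    have htrace := traceOfA hA
    obtain ⟨m', p', t', k, hk, ht', hf', hw, rfl⟩ : ∃ m' p' t', ∃ k ≤ m', t' 0 = ρ₀ ∧
        Follows P.stepA p' t' k ∧ pathWord p m = pathWord p' m' ∧ β = size P.stepA p' t' k := by
      match q' with
      | .init => exact absurd rfl hq'
      | .pair _ _ =>
        obtain ⟨m', p', t', -, ht', hf', -, -, hw, hβ⟩ := htrace
        exact ⟨m', p', t', m', le_rfl, ht', hf', hw, hβ⟩
      | .top _ _ => exact htrace
      | .bot =>
        obtain ⟨m', p', t', σ, -, -, -, hw, -⟩ := htrace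
        exact absurd hw (pathWord_ne_append_inr _ _ _ _)
    obtain ⟨rfl, hpp⟩ := pathWord_inj hw
    have hpp' : ∀ x ≤ k, p' x = p x := fun x hx => (hpp x (hx.trans hk)).symm
    refine ⟨k, hk, t', ht', hf'.congr hpp' fun _ _ => rfl, ?_, .inl hground⟩
    rwa [size_congr hpp' fun _ _ => rfl] at hrel

theorem groundedB_of_traceOrder {rel : Ordinal.{v} → Ordinal.{v} → Prop}
    (hord : P.TraceOrder X rel ν₀ τ₀ ρ₀) : P.GroundedB X ν₀ τ₀ := by
  rintro ν σ hfinal hreach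
  rcases hfinal with ⟨hna, hterm, hexcl⟩ | ⟨-, hg, -⟩
  · obtain ⟨w, α, hr⟩ := (WeightedAutomaton.reachable_iff P.ordWeightB).1 hreach
    obtain ⟨m, p, t, hp, ht, hf, rfl, hσ, -, -⟩ := traceOfB hr
    rw [← hσ] at hterm hexcl ⊢
    obtain ⟨k, -, t', -, -, -, h | h⟩ := hord m p t hp ht ⟨hf, hterm, hexcl⟩
    · exact h
    · exact absurd h.1 hna
  · exact hg

/-- The trace ordering implies inclusion of languages: a maximal run of the right-hand automaton
describes a right-hand trace, and the left-hand trace it is compared with, or a larger one, can be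
completed to a run of the approximate left-hand automaton. -/
theorem lang_of_traceOrder (hfin : P.FinitelyProgressing ν₀ ρ₀ τ₀)
    (hdyn : P.Dynamic ν₀ ρ₀ τ₀) (hbal : P.Balanced ν₀ ρ₀) (hρ₀ : ρ₀ ∈ P.valsA ν₀)
    (hτ₀ : τ₀ ∈ P.valsC ν₀) {M : ℕ}
    (hM : ∀ x y, ReachableStep P.stepA ν₀ ρ₀ x y → natStep P.stepA x y ≤ M)
    (hn : 2 + P.threshold * M * P.width + P.width ≤ n)
    {r : WithBot Ordinal.{v} → WithBot Ordinal.{v} → Prop} (hle : ∀ x y, r x y → x ≤ y)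
    (htr : ∀ x y z, r x y → y ≤ z → r x z)
    (hord : P.TraceOrder X (fun α β => r α β) ν₀ τ₀ ρ₀) (w : List P.Letter)
    (hw : (P.autB X ν₀ τ₀).lang w ≠ ⊥) :
    r ((P.autB X ν₀ τ₀).lang w) ((P.autA O n ν₀ ρ₀).lang w) := by
  classical
  obtain ⟨q, hq, α, hr, hα⟩ := WeightedAutomaton.exists_reaches_of_lang_ne_bot autB_weight hw
  rw [hα]
  have hA : ∀ (q' : P.StateA n) (β : Ordinal.{v}), q' ≠ .init → RunA O n ν₀ ρ₀ w q' β →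
      (β : WithBot Ordinal.{v}) ≤ (P.autA O n ν₀ ρ₀).lang w :=
    fun q' β hq' h => h.le_lang autA_weight hq'
  have htrace := traceOfB hr
  match q with
  | .init => exact hq.elim
  | .bot =>
    obtain ⟨m, p, t, σ, hp, ht, hf, hσ, ha, hng, hexcl, hσm, rfl, rfl⟩ := htrace
    rw [← hσ] at hng hexcl
    obtain ⟨k, -, t', ht', hf', hrel, h | ⟨-, rfl, heq⟩⟩ :=
      hord m p t hp ht ⟨hf, axiomatic_terminal P ha _, hexcl⟩
    · exact absurd h hng
    · rw [hσ] at heq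
      exact htr _ _ _ hrel (hA _ _ (by simp) (runA_bot hp ht' hρ₀ hf' ha σ hσm heq))
  | .pair ν σ =>
    obtain ⟨m, p, t, hp, ht, hf, rfl, hσ, rfl, rfl⟩ := htrace
    have hmax : P.IsPositiveMaximal X p t m := by
      rcases hq with ⟨-, hterm, hexcl⟩ | ⟨ha, -, hexcl⟩
      · rw [← hσ] at hterm hexcl
        exact ⟨hf, hterm, hexcl⟩
      · rw [← hσ] at hexcl
        exact ⟨hf, axiomatic_terminal P ha _, hexcl⟩
    obtain ⟨k, hkm, t', ht', hf', hrel, -⟩ := hord m p t hp ht hmax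
    rcases hkm.eq_or_lt with rfl | hkm
    · have hk := valsA_of_follows hf' (by rwa [hp, ht']) le_rfl
      exact htr _ _ _ hrel (hA _ _ (by simp) (runA_pair hp ht' hf' ⟨_, hk⟩))
    · let V := (Finset.Ioc k m).filter fun x => p x = p (k + 1)
      have hV : ∀ x, x ∈ V ↔ (k < x ∧ x ≤ m) ∧ p x = p (k + 1) := fun x => by simp [V]
      rcases le_or_gt V.card n with hcard | hcard
      · obtain ⟨i, hi⟩ := runA_top hp ht' hρ₀ hf' hkm (stepC_mem (hf k hkm)).1 hV hcard
        exact htr _ _ _ hrel (hA _ _ (by simp) hi)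
      · obtain ⟨i, t'', hki, him, ht'', hf'', hpi, hsize, hcard⟩ := exists_trace_of_recurrence
          hfin hdyn hbal hτ₀ hM hn (fun _ _ h => WithBot.coe_le_coe.1 (hle _ _ h)) hord hp ht hmax
          ht' hf' hV hcard
        obtain ⟨c, hc⟩ := runA_top hp ht'' hρ₀ hf'' him (stepC_mem (hf i him)).1
          (V := V.filter (i < ·)) (fun x => by
            rw [Finset.mem_filter, hV, hpi]
            constructor
            · rintro ⟨⟨h₁, h₂⟩, h₃⟩; exact ⟨⟨h₃, h₁.2⟩, h₂⟩
            · rintro ⟨h₁, h₂⟩; exact ⟨⟨⟨hki.trans h₁.1, h₁.2⟩, h₂⟩, h₁.1⟩) hcard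
        exact htr _ _ _ hrel ((WithBot.coe_le_coe.2 hsize).trans (hA _ _ (by simp) hc))

end PreProof

theorem mainTheorem3 (E : CyclicSystem.{u, v}) (O : OrdinalTraceFunction E) (X : ExclusionPredicate O)
    (P : PreProof E) (hP : P.IsCyclicProof)
    (ν : P.Node) (τ : E.TA) (hτ : τ ∈ P.valsA ν) (τ' : E.TC) (hτ' : τ' ∈ P.valsC ν)
    (hfin : P.FinitelyProgressing ν τ τ') (hdyn : P.Dynamic ν τ τ') (hbal : P.Balanced ν τ) :
    ∃ N : ℕ, (N : Ordinal.{v}) =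
        2 + (P.threshold : Ordinal.{v}) * P.maxStep ν τ * (P.width : Ordinal.{v}) + (P.width : Ordinal.{v}) ∧
      ∀ n ≥ N,
        ((P.autB X ν τ').LangLE (P.autA O n ν τ) ∧ P.GroundedB X ν τ' ↔ P.TraceLE X ν τ' τ) ∧
        ((P.autB X ν τ').LangLT (P.autA O n ν τ) ∧ P.GroundedB X ν τ' ↔ P.TraceLT X ν τ' τ) ∧
        (E.TraceInjective → (P.autA O n ν τ).FinitelyAmbiguous) := by
  obtain ⟨M, hM, hstep⟩ := PreProof.exists_maxStep_eq hfin.1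
  refine ⟨2 + P.threshold * M * P.width + P.width, by rw [hM]; push_cast; rfl, fun n hn => ?_⟩
  have hLE : P.TraceLE X ν τ' τ ↔
      P.TraceOrder X (fun α β => (α : WithBot Ordinal.{v}) ≤ β) ν τ' τ := by
    simp only [PreProof.TraceLE, WithBot.coe_le_coe]
  have hLT : P.TraceLT X ν τ' τ ↔
      P.TraceOrder X (fun α β => (α : WithBot Ordinal.{v}) < β) ν τ' τ := by
    simp only [PreProof.TraceLT, WithBot.coe_lt_coe]
  refine ⟨?_, ?_, PreProof.finitelyAmbiguous_autA⟩
  · rw [hLE]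
    constructor
    · rintro ⟨hlang, hg⟩
      exact PreProof.traceOrder_of_lang hτ' (fun _ _ => id) (fun _ _ _ => le_trans)
        (fun w _ => hlang w) hg
    · intro h
      refine ⟨fun w => ?_, PreProof.groundedB_of_traceOrder h⟩
      by_cases hw : (P.autB X ν τ').lang w = ⊥
      · rw [hw]
        exact bot_le
      · exact PreProof.lang_of_traceOrder hfin hdyn hbal hτ hτ' hstep hn (fun _ _ => id)
          (fun _ _ _ => le_trans) h w hw
  · rw [hLT]
    constructor
    · rintro ⟨hlang, hg⟩
      exact PreProof.traceOrder_of_lang hτ' (fun _ _ => le_of_lt) (fun _ _ _ => lt_of_le_of_lt)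
        hlang hg
    · intro h
      exact ⟨PreProof.lang_of_traceOrder hfin hdyn hbal hτ hτ' hstep hn (fun _ _ => le_of_lt)
        (fun _ _ _ => lt_of_lt_of_le) h, PreProof.groundedB_of_traceOrder h⟩
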